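/- Let $S^3$ be the group of unit quaternions, and let $S^3\times S^3$ carry its nearly Kähler structure: for $(U,V)\in T_{(p,q)}(S^3\times S^3)$, written as a pair of quaternions, $$J(U,V)=\tfrac{1}{\sqrt3}\,(2pq^{-1}V-U,\,-2qp^{-1}U+V),\qquad g(X,Y)=\tfrac12\big(\langle X,Y\rangle+\langle JX,JY\rangle\big),$$ where $\langle\cdot,\cdot\rangle$ is the product metric; let also $P(U,V)=(pq^{-1}V,qp^{-1}U)$. Let $M$ be a simply connected smooth surface and let $\phi=(p,q):M\to S^3\times S^3$ be an almost complex surface, i.e. a smooth immersion such that $d\phi(T_xM)$ is $J$-invariant for every $x\in M$. Local coordinates $(u,v)$ of $M$ with $J\phi_u=\phi_v$ are called isothermal. Let $\Lambda\,dz^2$ be the quadratic differential on $M$ given in isothermal coordinates $z=u+iv$ by $\Lambda=g(P\phi_z,\phi_z)$ ($g$ and $P$ extended complex bilinearly); without coordinates, its value at a tangent vector $w$ is $g(PZ,Z)$ with $Z=\frac12(X-iJX)$, $X=d\phi(w)$. In isothermal coordinates put $$\alpha=p^{-1}p_u,\quad \beta=p^{-1}p_v,\quad \tilde\alpha=-\tfrac12\alpha+\tfrac{\sqrt3}{2}\beta,\quad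 \tilde\beta=-\tfrac{\sqrt3}{2}\alpha-\tfrac12\beta,$$ which are functions with values in the imaginary quaternions, identified with $\mathbb R^3$. Suppose that $\Lambda\,dz^2=0$ on $M$. Then there is a smooth immersion $\epsilon:M\to\mathbb R^3$ such that 1. $\epsilon_u=\tilde\alpha$ and $\epsilon_v=\tilde\beta$ in all isothermal coordinates $(u,v)$ of $M$; in a form without coordinates, $d\epsilon(X)=-\frac12\,p^{-1}dp(X)+\frac{\sqrt3}{2}\,p^{-1}dp(Y)$ whenever $X,Y\in T_xM$ satisfy $d\phi(Y)=J\,d\phi(X)$; 2. $\epsilon$ solves Wente's $H$-surface equation $\epsilon_{uu}+\epsilon_{vv}=-\frac{4}{\sqrt3}\,\epsilon_u\times\epsilon_v$ in all isothermal coordinates $(u,v)$ of $M$; 3. $\epsilon$ has constant mean curvature $-\frac{2}{\sqrt3}$, where the mean curvature is half the trace of the second fundamental form with respect to the unit normal $\epsilon_u\times\epsilon_v/|\epsilon_u\times\epsilon_v|$, for any local coordinates $(u,v)$ of $M$ that are positive for the orientation of $M$ induced by $J$; 4. the metric induced on $M$ by $\epsilon$ is half of the metric induced by $\phi$ from $g$.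 -/

import Mathlib

open scoped Manifold ContDiff Quaternion RealInnerProductSpace

noncomputable section

namespace NearlyKaehlerS3

/-- `ℝ⁴`, seen as the real quaternions, has dimension `3 + 1`; this gives the unit sphere
of the quaternions Mathlib's structure of a smooth 3-manifold. -/
instance factFinrankQuaternion : Fact (Module.finrank ℝ ℍ[ℝ] = 3 + 1) :=
  ⟨Quaternion.finrank_eq_four⟩

/-- The Euclidean plane, the model space of surfaces. -/
abbrev E2 : Type := EuclideanSpace ℝ (Fin 2)

/-- Euclidean 3-space. -/
abbrev E3 : Type := EuclideanSpace ℝ (Fin 3)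

/-- The 3-sphere of unit quaternions. -/
abbrev S3 : Type := Metric.sphere (0 : ℍ[ℝ]) 1

/-! ### The nearly Kähler structure of `S³ × S³`

A tangent vector of `S³ × S³` at `m = (p, q)` is a pair `(U, V)` of quaternions, with `U`
tangent to `S³` at `p` and `V` tangent to `S³` at `q`.  The tensors below are given by formulas
which make sense for all pairs of quaternions. -/

/-- The almost complex structure
`J (U, V) = (1 / √3) (2 p q⁻¹ V - U, -2 q p⁻¹ U + V)` at `(p, q)`. -/
def acs (m : S3 × S3) (X : ℍ[ℝ] × ℍ[ℝ]) : ℍ[ℝ] × ℍ[ℝ] :=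
  (1 / √3 : ℝ) •
    (2 * ((m.1 : ℍ[ℝ]) * (m.2 : ℍ[ℝ])⁻¹ * X.2) - X.1,
      -2 * ((m.2 : ℍ[ℝ]) * (m.1 : ℍ[ℝ])⁻¹ * X.1) + X.2)

/-- The almost product structure `P (U, V) = (p q⁻¹ V, q p⁻¹ U)` at `(p, q)`. -/
def aps (m : S3 × S3) (X : ℍ[ℝ] × ℍ[ℝ]) : ℍ[ℝ] × ℍ[ℝ] :=
  ((m.1 : ℍ[ℝ]) * (m.2 : ℍ[ℝ])⁻¹ * X.2, (m.2 : ℍ[ℝ]) * (m.1 : ℍ[ℝ])⁻¹ * X.1)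

/-- The standard product metric. -/
def prodMetric (X Y : ℍ[ℝ] × ℍ[ℝ]) : ℝ := ⟪X.1, Y.1⟫ + ⟪X.2, Y.2⟫

/-- The nearly Kähler metric `g (X, Y) = (⟨X, Y⟩ + ⟨J X, J Y⟩) / 2`. -/
def nkMetric (m : S3 × S3) (X Y : ℍ[ℝ] × ℍ[ℝ]) : ℝ :=
  (1 / 2) * (prodMetric X Y + prodMetric (acs m X) (acs m Y))

/-- The complex bilinear extension of `g`, evaluated at the complexified vectors
`X + i Y` and `X' + i Y'`. -/
def nkMetricC (m : S3 × S3) (X Y X' Y' : ℍ[ℝ] × ℍ[ℝ]) : ℂ :=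
  ⟨nkMetric m X X' - nkMetric m Y Y', nkMetric m X Y' + nkMetric m Y X'⟩

/-! ### Euclidean 3-space -/

/-- The vector in `ℝ³` of the imaginary part of a quaternion. -/
def imVec (a : ℍ[ℝ]) : E3 := !₂[a.imI, a.imJ, a.imK]

/-- The cross product of `ℝ³`. -/
def cross (x y : E3) : E3 := WithLp.toLp 2 (crossProduct x.ofLp y.ofLp)

/-- The partial derivative of `f` in the direction of the `i`-th coordinate; `i = 0` stands for
`u` and `i = 1` for `v`. -/
def pd {F : Type*} [NormedAddCommGroup F] [NormedSpace ℝ F] (i : Fin 2) (f : E2 → F) : E2 → F :=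
  fun y => fderiv ℝ f y (EuclideanSpace.single i 1)

/-- The unit normal `f_u × f_v / |f_u × f_v|` of a parametrized surface in `ℝ³`. -/
def unitNormal (f : E2 → E3) (y : E2) : E3 :=
  ‖cross (pd 0 f y) (pd 1 f y)‖⁻¹ • cross (pd 0 f y) (pd 1 f y)

/-- The mean curvature (half the trace of the second fundamental form with respect to
`unitNormal f`) of a parametrized surface in `ℝ³`,
`H = (E n - 2 F m + G l) / (2 (E G - F ^ 2))`, where `E`, `F`, `G` and `l`, `m`, `n` are the
coefficients of the first and of the second fundamental form. -/
def meanCurvature (f : E2 → E3) (y : E2) : ℝ :=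
  (⟪pd 0 f y, pd 0 f y⟫ * ⟪pd 1 (pd 1 f) y, unitNormal f y⟫
      - 2 * ⟪pd 0 f y, pd 1 f y⟫ * ⟪pd 1 (pd 0 f) y, unitNormal f y⟫
      + ⟪pd 1 f y, pd 1 f y⟫ * ⟪pd 0 (pd 0 f) y, unitNormal f y⟫)
    / (2 * (⟪pd 0 f y, pd 0 f y⟫ * ⟪pd 1 f y, pd 1 f y⟫ - ⟪pd 0 f y, pd 1 f y⟫ ^ 2))

/-! ### Surfaces in `S³ × S³` -/

section Surface

variable {M : Type*} [TopologicalSpace M] [ChartedSpace E2 M]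

/-- A smooth immersion of a surface: a smooth map with injective differentials. -/
def IsSmoothImmersion {F : Type*} [NormedAddCommGroup F] [NormedSpace ℝ F]
    {H : Type*} [TopologicalSpace H] (I : ModelWithCorners ℝ F H)
    {N : Type*} [TopologicalSpace N] [ChartedSpace H N] (f : M → N) : Prop :=
  ContMDiff (𝓡 2) I ∞ f ∧ ∀ x : M, Function.Injective (mfderiv (𝓡 2) I f x)

/-- The map `φ = (p, q) : M → S³ × S³` followed by the inclusion into `ℍ × ℍ`. -/
def ambient (φ : M → S3 × S3) : M → ℍ[ℝ] × ℍ[ℝ] := fun x => ((φ x).1, (φ x).2)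

/-- The differential `dφ` of `φ : M → S³ × S³` at `x`, tangent vectors of `S³ × S³` being written
as pairs of quaternions. -/
def diffl (φ : M → S3 × S3) (x : M) : TangentSpace (𝓡 2) x →L[ℝ] ℍ[ℝ] × ℍ[ℝ] :=
  mfderiv (𝓡 2) 𝓘(ℝ, ℍ[ℝ] × ℍ[ℝ]) (ambient φ) x

/-- `φ : M → S³ × S³` is an almost complex surface: a smooth immersion, the tangent spaces of
which are invariant under `J`. -/
def IsAlmostComplexSurface (φ : M → S3 × S3) : Prop :=
  IsSmoothImmersion ((𝓡 3).prod (𝓡 3)) φ ∧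
    ∀ (x : M) (v : TangentSpace (𝓡 2) x), ∃ w : TangentSpace (𝓡 2) x,
      diffl φ x w = acs (φ x) (diffl φ x v)

/-- The quadratic differential `Λ dz²` of an almost complex surface, as a complex valued quadratic
form on the tangent spaces of `M`.  Its value at `v` is `g (P Z, Z)`, with the complex bilinear
extensions of `g` and `P`, where `Z = (X - i J X) / 2` is the part of type `(1, 0)` of
`X = dφ v`.  In coordinates `z = u + i v` with `J φ_u = φ_v` the vector `a ∂_u + b ∂_v` has
`Z = (a + i b) φ_z`, so that the value is `Λ (a + i b) ^ 2` with `Λ = g (P φ_z, φ_z)`. -/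
def holDiff (φ : M → S3 × S3) (x : M) (v : TangentSpace (𝓡 2) x) : ℂ :=
  let A : ℍ[ℝ] × ℍ[ℝ] := (1 / 2 : ℝ) • diffl φ x v
  let B : ℍ[ℝ] × ℍ[ℝ] := -((1 / 2 : ℝ) • acs (φ x) (diffl φ x v))
  nkMetricC (φ x) (aps (φ x) A) (aps (φ x) B) A B

/-- `p⁻¹ dp`, as a form on `M` with values in the imaginary quaternions `ℝ³`. -/
def logDiff (φ : M → S3 × S3) (x : M) (v : TangentSpace (𝓡 2) x) : E3 :=
  imVec (((φ x).1 : ℍ[ℝ])⁻¹ * (diffl φ x v).1)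

/-- The local coordinates `(u, v)` given by the smooth chart `e` satisfy `J φ_u = φ_v`. -/
def IsIsothermal (φ : M → S3 × S3) (e : OpenPartialHomeomorph M E2) : Prop :=
  e ∈ IsManifold.maximalAtlas (𝓡 2) ∞ M ∧
    ∀ y ∈ e.target,
      acs (φ (e.symm y)) (pd 0 (ambient φ ∘ e.symm) y) = pd 1 (ambient φ ∘ e.symm) y

/-- The smooth chart `e` is positive for the orientation of the surface by `J`, in which
`(X, J X)` is positive for every tangent vector `X ≠ 0`. -/
def IsPositiveChart (φ : M → S3 × S3) (e : OpenPartialHomeomorph M E2) : Prop :=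
  e ∈ IsManifold.maximalAtlas (𝓡 2) ∞ M ∧
    ∀ y ∈ e.target, ∃ a b : ℝ, 0 < b ∧
      acs (φ (e.symm y)) (pd 0 (ambient φ ∘ e.symm) y) =
        a • pd 0 (ambient φ ∘ e.symm) y + b • pd 1 (ambient φ ∘ e.symm) y

/-- `α = p⁻¹ p_u` in the coordinates `(u, v)` given by `e`. -/
def alpha (φ : M → S3 × S3) (e : OpenPartialHomeomorph M E2) (y : E2) : E3 :=
  imVec (((φ (e.symm y)).1 : ℍ[ℝ])⁻¹ * (pd 0 (ambient φ ∘ e.symm) y).1)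

/-- `β = p⁻¹ p_v` in the coordinates `(u, v)` given by `e`. -/
def beta (φ : M → S3 × S3) (e : OpenPartialHomeomorph M E2) (y : E2) : E3 :=
  imVec (((φ (e.symm y)).1 : ℍ[ℝ])⁻¹ * (pd 1 (ambient φ ∘ e.symm) y).1)

/-- `α̃ = - α / 2 + (√3 / 2) β`. -/
def alphaTilde (φ : M → S3 × S3) (e : OpenPartialHomeomorph M E2) (y : E2) : E3 :=
  (-(1 / 2) : ℝ) • alpha φ e y + (√3 / 2 : ℝ) • beta φ e y

/-- `β̃ = - (√3 / 2) α - β / 2`. -/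
def betaTilde (φ : M → S3 × S3) (e : OpenPartialHomeomorph M E2) (y : E2) : E3 :=
  (-(√3 / 2) : ℝ) • alpha φ e y + (-(1 / 2) : ℝ) • beta φ e y

/-- The differential `dε` of `ε : M → ℝ³` at `x`. -/
def diffl3 (ε : M → E3) (x : M) : TangentSpace (𝓡 2) x →L[ℝ] E3 :=
  mfderiv (𝓡 2) 𝓘(ℝ, E3) ε x

end Surface

end NearlyKaehlerS3

end

open NearlyKaehlerS3

noncomputable section

namespace NearlyKaehlerS3

open scoped Topology

/-! Write A = p⁻¹dp and C = q⁻¹dq, forms on M with values in ℝ³. In this left invariant frame J and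
P have constant coefficients: J sends (A, C) to (2C − A, C − 2A)/√3 and P swaps A and C. Hence (C +
A)∘J = √3 (C − A), and A∘J = (2C − A)/√3 gives C − A = (−A + √3 A∘J)/2, the form prescribed for dε.

Both A and C satisfy the Maurer–Cartan equation with curvature term −2 A₀×A₁, respectively −2 C₀×C₁.
On a J-invariant surface both products equal (C₀ − A₀)×(C₁ − A₁) (`ACRel.cross_eq`). So C − A is
closed for every almost complex surface (`ACFrame.closed`), and since M is simply connected it has a
primitive ε (`exists_primitive`). In the sum C + A the curvature terms add up instead
(`ACFrame.pd_add_sub`); as C + A is √3 times C − A composed with J, up to sign, this identity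
becomes Wente's equation in isothermal coordinates.

The condition Λ = 0 says |A(v)|² = |C(v)|² = 2⟨A(v), C(v)⟩ for all v
(`inner_lg_of_holDiff_eq_zero`). It makes C − A injective and, by polarization, makes ε pull the
Euclidean metric back to g/2 (`inner_diffForm`). So ε is a conformal immersion, for which the
equation for C + A is the constancy of the mean curvature. -/

/-! ### Gluing local functions along a covering space -/

/-- The transition data of a family of functions which differ by locally constant functions: the
bundle of their germs up to constants, with discrete fibres. -/
def primitiveCore {B ι F : Type*} [TopologicalSpace B] [AddCommGroup F] [TopologicalSpace F]
    [DiscreteTopology F]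
    (U : ι → Set B) (hU : ∀ i, IsOpen (U i)) (idx : B → ι) (hidx : ∀ x, x ∈ U (idx x))
    (f : ι → B → F)
    (hf : ∀ i j, ∀ y ∈ U i ∩ U j, ∀ᶠ z in 𝓝 y, f i z - f j z = f i y - f j y) :
    FiberBundleCore ι B F where
  baseSet := U
  isOpen_baseSet := hU
  indexAt := idx
  mem_baseSet_at := hidx
  -- The sign makes v + f i b the same in every trivialization.
  coordChange i j b v := v + (f i b - f j b)
  coordChange_self i x _ v := by simp
  continuousOn_coordChange i j := by
    rintro ⟨y, v⟩ ⟨hy, -⟩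
    apply ContinuousAt.continuousWithinAt
    rw [ContinuousAt, nhds_prod_eq]
    -- Near y the coordinate change is translation by a fixed element, continuous on the discrete
    -- fibre.
    have h1 : Filter.Tendsto (fun p : B × F => p.2 + (f i y - f j y)) (𝓝 y ×ˢ 𝓝 v)
        (𝓝 (v + (f i y - f j y))) :=
      ((continuous_of_discreteTopology (f := fun w : F => w + (f i y - f j y))).tendsto v).comp
        Filter.tendsto_snd
    refine h1.congr' ?_
    filter_upwards [(hf i j y hy).prod_inl (𝓝 v)] with p hp
    rw [hp]
  coordChange_comp i j k x _ v := by abel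

/-- On a simply connected space, local functions which differ by locally constant functions come
from one global function, up to locally constant functions. -/
theorem exists_glue_of_simplyConnected {B ι F : Type*} [TopologicalSpace B]
    [SimplyConnectedSpace B] [LocallyPathConnectedSpace B] [AddCommGroup F]
    (U : ι → Set B) (hU : ∀ i, IsOpen (U i)) (hcov : ∀ x, ∃ i, x ∈ U i) (f : ι → B → F)
    (hf : ∀ i j, ∀ y ∈ U i ∩ U j, ∀ᶠ z in 𝓝 y, f i z - f j z = f i y - f j y) :
    ∃ g : B → F, ∀ i, ∀ y ∈ U i, ∀ᶠ z in 𝓝 y, g z - f i z = g y - f i y := by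
  -- The discrete topology on the fibre makes the bundle a covering.
  let _ : TopologicalSpace F := ⊥
  have _ : DiscreteTopology F := ⟨rfl⟩
  choose idx hidx using hcov
  let Z := primitiveCore U hU idx hidx f hf
  have hc : IsCoveringMap Z.proj := FiberBundle.isCoveringMap (F := F) (E := Z.Fiber)
  obtain ⟨b⟩ : Nonempty B := inferInstance
  -- The identity of a simply connected base lifts through the covering: a global section.
  obtain ⟨s, ⟨-, hs⟩, -⟩ := hc.existsUnique_continuousMap_lifts (ContinuousMap.id B) b
    ⟨b, (0 : F)⟩ rfl
  have hs' : ∀ y, (s y).1 = y := fun y => congrFun hs y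
  let σ : B → F := fun y => (s y).2
  have key : ∀ i, ∀ y ∈ U i, (Z.localTriv i (s y)).2 + f i y = σ y + f (idx y) y := by
    intro i y hy
    have : (Z.localTriv i (s y)).2 = σ y + (f (idx (s y).1) (s y).1 - f i (s y).1) := rfl
    rw [this, hs']
    abel
  refine ⟨fun y => σ y + f (idx y) y, fun i y hy => ?_⟩
  -- By `key` this fibre coordinate is the glued function minus f i; being continuous into a
  -- discrete space, it is locally constant.
  have hct : ContinuousAt (fun z => (Z.localTriv i (s z)).2) y := by
    refine continuous_snd.continuousAt.comp (ContinuousAt.comp ?_ s.continuous.continuousAt)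
    apply (Z.localTriv i).continuousAt
    rw [Z.mem_localTriv_source, hs' y]
    exact hy
  have hev := hct (show {(Z.localTriv i (s y)).2} ∈ 𝓝 (Z.localTriv i (s y)).2 from by simp)
  filter_upwards [hev, (hU i).mem_nhds hy] with z hz hzU
  have hz' : (Z.localTriv i (s z)).2 = (Z.localTriv i (s y)).2 := hz
  simp only [← key i z hzU, ← key i y hy, hz', add_sub_cancel_right]

/-! ### Primitives of closed forms on simply connected manifolds -/

section Primitive

variable {E F M : Type*} [NormedAddCommGroup E] [NormedSpace ℝ E] [NormedAddCommGroup F]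
  [NormedSpace ℝ F] [TopologicalSpace M] [ChartedSpace E M]

theorem exists_hasFDerivAt_comp_symm {e : OpenPartialHomeomorph M E}
    (he : e ∈ IsManifold.maximalAtlas 𝓘(ℝ, E) ∞ M) {f : M → F} {y : E} (hy : y ∈ e.target)
    {f' : TangentSpace 𝓘(ℝ, E) (e.symm y) →L[ℝ] F}
    (hf : HasMFDerivAt 𝓘(ℝ, E) 𝓘(ℝ, F) f (e.symm y) f') :
    ∃ D : E →L[ℝ] F, HasFDerivAt (f ∘ e.symm) D y ∧
      ∀ v, D v = f' (mfderiv 𝓘(ℝ, E) 𝓘(ℝ, E) e.symm y v) := by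
  have h := (contMDiffOn_symm_of_mem_maximalAtlas he).contMDiffAt (e.open_target.mem_nhds hy)
  have h2 := (h.mdifferentiableAt (by simp)).hasMFDerivAt
  exact ⟨_, hasMFDerivAt_iff_hasFDerivAt.1 (HasMFDerivAt.comp y hf h2), fun v => rfl⟩

theorem fderiv_comp_symm_apply {e : OpenPartialHomeomorph M E}
    (he : e ∈ IsManifold.maximalAtlas 𝓘(ℝ, E) ∞ M) {f : M → F} {y : E} (hy : y ∈ e.target)
    {f' : TangentSpace 𝓘(ℝ, E) (e.symm y) →L[ℝ] F}
    (hf : HasMFDerivAt 𝓘(ℝ, E) 𝓘(ℝ, F) f (e.symm y) f') (v : E) :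
    fderiv ℝ (f ∘ e.symm) y v = f' (mfderiv 𝓘(ℝ, E) 𝓘(ℝ, E) e.symm y v) := by
  obtain ⟨D, hD, hDv⟩ := exists_hasFDerivAt_comp_symm he hy hf
  rw [hD.fderiv, hDv]

theorem hasMFDerivAt_comp_chart {e : OpenPartialHomeomorph M E}
    (he : e ∈ IsManifold.maximalAtlas 𝓘(ℝ, E) ∞ M) {f : E → F} {x : M} (hx : x ∈ e.source)
    {f' : E →L[ℝ] F} (hf : HasFDerivAt f f' (e x)) {k : TangentSpace 𝓘(ℝ, E) x →L[ℝ] F}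
    (hk : ∀ v, k v = f' (mfderiv 𝓘(ℝ, E) 𝓘(ℝ, E) e x v)) :
    HasMFDerivAt 𝓘(ℝ, E) 𝓘(ℝ, F) (f ∘ e) x k := by
  have h := (contMDiffOn_of_mem_maximalAtlas he).contMDiffAt (e.open_source.mem_nhds hx)
  have h2 := (h.mdifferentiableAt (by simp)).hasMFDerivAt
  have h3 := HasMFDerivAt.comp x hf.hasMFDerivAt h2
  exact h3.congr_mfderiv (ContinuousLinearMap.ext fun v => (hk v).symm)

/-- Read in a chart, the difference has zero derivative on a ball, which is convex. This is the
compatibility that the gluing needs. -/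
theorem eventually_sub_eq_of_hasMFDerivAt [IsManifold 𝓘(ℝ, E) ∞ M] {f g : M → F}
    {η : ∀ x : M, TangentSpace 𝓘(ℝ, E) x →L[ℝ] F} {y : M}
    (hf : ∀ᶠ z in 𝓝 y, HasMFDerivAt 𝓘(ℝ, E) 𝓘(ℝ, F) f z (η z))
    (hg : ∀ᶠ z in 𝓝 y, HasMFDerivAt 𝓘(ℝ, E) 𝓘(ℝ, F) g z (η z)) :
    ∀ᶠ z in 𝓝 y, f z - g z = f y - g y := by
  let e := chartAt E y
  have he : e ∈ IsManifold.maximalAtlas 𝓘(ℝ, E) ∞ M := IsManifold.chart_mem_maximalAtlas y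
  have hys : y ∈ e.source := mem_chart_source E y
  have hyt : e y ∈ e.target := e.map_source hys
  have hev : ∀ᶠ z in 𝓝 (e y), HasFDerivAt ((f - g) ∘ e.symm) (0 : E →L[ℝ] F) z := by
    have h1 := (e.tendsto_symm hys).eventually (hf.and hg)
    filter_upwards [h1, e.open_target.mem_nhds hyt] with z hz hzt
    obtain ⟨D, hD, hDv⟩ := exists_hasFDerivAt_comp_symm he hzt hz.1
    obtain ⟨D', hD', hDv'⟩ := exists_hasFDerivAt_comp_symm he hzt hz.2
    have hDD : D = D' := ContinuousLinearMap.ext fun v => (hDv v).trans (hDv' v).symm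
    have h2 := hD.sub hD'
    rwa [hDD, sub_self] at h2
  obtain ⟨r, hr, hball⟩ := Metric.eventually_nhds_iff_ball.1 hev
  have hconst : ∀ z ∈ Metric.ball (e y) r, ((f - g) ∘ e.symm) z = ((f - g) ∘ e.symm) (e y) := by
    intro z hz
    refine (convex_ball (e y) r).is_const_of_fderivWithin_eq_zero (𝕜 := ℝ)
      (fun w hw => (hball w hw).differentiableAt.differentiableWithinAt) (fun w hw => ?_) hz
      (Metric.mem_ball_self hr)
    rw [fderivWithin_of_isOpen Metric.isOpen_ball hw, (hball w hw).fderiv]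
  have h3 := (e.continuousAt hys).eventually (Metric.ball_mem_nhds (e y) hr)
  filter_upwards [h3, e.open_source.mem_nhds hys] with z hz hzs
  have := hconst _ hz
  simpa [e.left_inv hzs, e.left_inv hys] using this

/-- On a simply connected manifold, a form with local primitives has a primitive. -/
theorem exists_primitive [IsManifold 𝓘(ℝ, E) ∞ M] [SimplyConnectedSpace M]
    (η : ∀ x : M, TangentSpace 𝓘(ℝ, E) x →L[ℝ] F)
    (hη : ∀ x, ∃ U : Set M, IsOpen U ∧ x ∈ U ∧ ∃ f : M → F,
      ∀ y ∈ U, HasMFDerivAt 𝓘(ℝ, E) 𝓘(ℝ, F) f y (η y)) :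
    ∃ ε : M → F, ∀ x, HasMFDerivAt 𝓘(ℝ, E) 𝓘(ℝ, F) ε x (η x) := by
  choose U hU hxU f hf using hη
  have : LocallyPathConnectedSpace M := ChartedSpace.locallyPathConnectedSpace E M
  obtain ⟨ε, hε⟩ := exists_glue_of_simplyConnected U hU (fun x => ⟨x, hxU x⟩) f
    (fun i j y hy => eventually_sub_eq_of_hasMFDerivAt (η := η)
      (by filter_upwards [(hU i).mem_nhds hy.1] with z hz using hf i z hz)
      (by filter_upwards [(hU j).mem_nhds hy.2] with z hz using hf j z hz))
  refine ⟨ε, fun x => ?_⟩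
  -- Near x the glued function is the local primitive plus this constant.
  have h := (hf x x (hxU x)).add (hasMFDerivAt_const (I := 𝓘(ℝ, E)) (I' := 𝓘(ℝ, F))
    (ε x - f x x) x)
  have h' : HasMFDerivAt 𝓘(ℝ, E) 𝓘(ℝ, F) (f x + fun _ => ε x - f x x) x (η x) := by
    convert h using 1
    exact iff_of_eq (congrArg _ (add_zero (η x : E →L[ℝ] F)).symm)
  refine h'.congr_of_eventuallyEq ?_
  filter_upwards [hε x x (hxU x)] with z hz
  simp [← hz]

end Primitive

/-! ### Vector algebra -/

theorem inner_E3 (x y : E3) : ⟪x, y⟫ = x 0 * y 0 + x 1 * y 1 + x 2 * y 2 := by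
  simp [PiLp.inner_apply, Fin.sum_univ_three]
  ring

theorem cross_zero (x y : E3) : cross x y 0 = x 1 * y 2 - x 2 * y 1 := rfl

theorem cross_one (x y : E3) : cross x y 1 = x 2 * y 0 - x 0 * y 2 := rfl

theorem cross_two (x y : E3) : cross x y 2 = x 0 * y 1 - x 1 * y 0 := rfl

theorem E3_ext {x y : E3} (h0 : x 0 = y 0) (h1 : x 1 = y 1) (h2 : x 2 = y 2) : x = y := by
  ext i
  fin_cases i
  exacts [h0, h1, h2]

theorem inner_cross_self_left (x y : E3) : ⟪x, cross x y⟫ = 0 := by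
  simp only [inner_E3, cross_zero, cross_one, cross_two]
  ring

theorem inner_cross_self_right (x y : E3) : ⟪y, cross x y⟫ = 0 := by
  simp only [inner_E3, cross_zero, cross_one, cross_two]
  ring

theorem inner_cross_cross (x y : E3) :
    ⟪cross x y, cross x y⟫ = ⟪x, x⟫ * ⟪y, y⟫ - ⟪x, y⟫ ^ 2 := by
  simp only [inner_E3, cross_zero, cross_one, cross_two]
  ring

theorem sqrt_three_ne_zero : (√3 : ℝ) ≠ 0 := by positivity

theorem sqrt_three_mul_self : (√3 : ℝ) * √3 = 3 := Real.mul_self_sqrt (by norm_num)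

/-- The relation between the components `A₀, A₁` of `p⁻¹ dp` and `C₀, C₁` of `q⁻¹ dq` in a chart
in which `J ∂₀ = a ∂₀ + b ∂₁`. -/
structure ACRel (a b : ℝ) (A₀ A₁ C₀ C₁ : E3) : Prop where
  fst : (1 / √3 : ℝ) • ((2 : ℝ) • C₀ - A₀) = a • A₀ + b • A₁
  snd : (1 / √3 : ℝ) • (C₀ - (2 : ℝ) • A₀) = a • C₀ + b • C₁

namespace ACRel

variable {a b : ℝ} {A₀ A₁ C₀ C₁ : E3}

/-- The identity (C + A)∘J = √3 (C − A) at ∂₀, obtained by adding the two components; subtracting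
them gives the companion `sub_eq`. -/
theorem add_eq (h : ACRel a b A₀ A₁ C₀ C₁) :
    a • (C₀ + A₀) + b • (C₁ + A₁) = (√3 : ℝ) • (C₀ - A₀) := by
  have hs : (√3 : ℝ) = (1 / √3) * 3 := by
    have := sqrt_three_mul_self
    have := sqrt_three_ne_zero
    field_simp
    linarith
  rw [hs]
  linear_combination (norm := module) -h.fst - h.snd

theorem sub_eq (h : ACRel a b A₀ A₁ C₀ C₁) :
    C₀ + A₀ = -(√3 : ℝ) • (a • (C₀ - A₀) + b • (C₁ - A₁)) := by
  have h1 : a • (C₀ - A₀) + b • (C₁ - A₁) = -(1 / √3 : ℝ) • (C₀ + A₀) := by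
    linear_combination (norm := module) h.fst - h.snd
  rw [h1, smul_smul]
  have := sqrt_three_ne_zero
  rw [show -(√3 : ℝ) * -(1 / √3) = 1 by field_simp, one_smul]

theorem snd_eq (h : ACRel a b A₀ A₁ C₀ C₁) (hb : b ≠ 0) :
    A₁ = b⁻¹ • ((1 / √3 : ℝ) • ((2 : ℝ) • C₀ - A₀) - a • A₀) ∧
      C₁ = b⁻¹ • ((1 / √3 : ℝ) • (C₀ - (2 : ℝ) • A₀) - a • C₀) := by
  rw [h.fst, h.snd]
  simp [smul_smul, hb]

/-- A₁ and C₁ are combinations of A₀ and C₀, so each product is a multiple of A₀ × C₀, and the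
multiple is 2/(√3 b) in all three cases. -/
theorem cross_eq (h : ACRel a b A₀ A₁ C₀ C₁) (hb : b ≠ 0) :
    cross A₀ A₁ = cross (C₀ - A₀) (C₁ - A₁) ∧ cross C₀ C₁ = cross (C₀ - A₀) (C₁ - A₁) := by
  obtain ⟨h1, h2⟩ := h.snd_eq hb
  rw [h1, h2]
  constructor <;> apply E3_ext <;>
  · simp only [cross_zero, cross_one, cross_two, PiLp.sub_apply, PiLp.smul_apply, smul_eq_mul]
    ring

end ACRel

/-! ### Calculus of closed vector valued forms in the plane -/

theorem E2_eq (v : E2) :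
    v = v 0 • EuclideanSpace.single 0 (1 : ℝ) + v 1 • EuclideanSpace.single 1 (1 : ℝ) := by
  ext i
  fin_cases i <;> simp

/-- The bilinear map underlying `cross`. -/
def crossL : E3 →ₗ[ℝ] E3 →ₗ[ℝ] E3 :=
  LinearMap.mk₂ ℝ cross
    (fun x y z => by
      apply E3_ext <;> simp only [cross_zero, cross_one, cross_two, PiLp.add_apply] <;> ring)
    (fun c x y => by
      apply E3_ext <;>
        simp only [cross_zero, cross_one, cross_two, PiLp.smul_apply, smul_eq_mul] <;> ring)
    (fun x y z => by
      apply E3_ext <;> simp only [cross_zero, cross_one, cross_two, PiLp.add_apply] <;> ring)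
    (fun c x y => by
      apply E3_ext <;>
        simp only [cross_zero, cross_one, cross_two, PiLp.smul_apply, smul_eq_mul] <;> ring)

theorem differentiableAt_cross {f g : E2 → E3} {y : E2} (hf : DifferentiableAt ℝ f y)
    (hg : DifferentiableAt ℝ g y) : DifferentiableAt ℝ (fun z => cross (f z) (g z)) y := by
  have h := (crossL.toContinuousBilinearMap).isBoundedBilinearMap.differentiableAt (f y, g y)
  have h' := DifferentiableAt.comp y h (hf.prodMk hg)
  exact h'

/-- Moving the derivative onto n makes the normal part of a derivative linear in the value of f at
y. The coefficients of a tangential field then never have to be differentiated. -/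
theorem inner_pd_eq_neg_of_inner_eq_zero {f n : E2 → E3} {y : E2} (i : Fin 2)
    (hf : DifferentiableAt ℝ f y) (hn : DifferentiableAt ℝ n y)
    (h : ∀ᶠ z in 𝓝 y, ⟪f z, n z⟫ = 0) : ⟪pd i f y, n y⟫ = -⟪f y, pd i n y⟫ := by
  have h1 : fderiv ℝ (fun z => ⟪f z, n z⟫) y = 0 := by
    have : (fun z => ⟪f z, n z⟫) =ᶠ[𝓝 y] fun _ => (0 : ℝ) := h
    rw [this.fderiv_eq]
    simp
  have h2 := fderiv_inner_apply ℝ hf hn (EuclideanSpace.single i 1)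
  rw [h1] at h2
  simp only [_root_.zero_apply] at h2
  simp only [pd]
  linarith

theorem pd_add {f g : E2 → E3} {y : E2} (i : Fin 2) (hf : DifferentiableAt ℝ f y)
    (hg : DifferentiableAt ℝ g y) : pd i (fun z => f z + g z) y = pd i f y + pd i g y := by
  simp only [pd]
  rw [fderiv_fun_add hf hg]
  rfl

theorem pd_sub {f g : E2 → E3} {y : E2} (i : Fin 2) (hf : DifferentiableAt ℝ f y)
    (hg : DifferentiableAt ℝ g y) : pd i (fun z => f z - g z) y = pd i f y - pd i g y := by
  simp only [pd]
  rw [fderiv_fun_sub hf hg]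
  rfl

theorem pd_const_smul {f : E2 → E3} {y : E2} (i : Fin 2) (c : ℝ) (hf : DifferentiableAt ℝ f y) :
    pd i (fun z => c • f z) y = c • pd i f y := by
  simp only [pd]
  rw [fderiv_fun_const_smul hf]
  rfl

theorem pd_congr {F : Type*} [NormedAddCommGroup F] [NormedSpace ℝ F] {f g : E2 → F} {y : E2}
    (i : Fin 2) (h : f =ᶠ[𝓝 y] g) : pd i f y = pd i g y := by
  simp only [pd, h.fderiv_eq]

/-- The components `A₀, A₁` of `p⁻¹ dp` and `C₀, C₁` of `q⁻¹ dq` for a `J`-invariant surface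
near the point `y` of a chart. -/
structure ACFrame (y : E2) (A₀ A₁ C₀ C₁ : E2 → E3) : Prop where
  diffA₀ : DifferentiableAt ℝ A₀ y
  diffA₁ : DifferentiableAt ℝ A₁ y
  diffC₀ : DifferentiableAt ℝ C₀ y
  diffC₁ : DifferentiableAt ℝ C₁ y
  structA : pd 0 A₁ y - pd 1 A₀ y = -(2 : ℝ) • cross (A₀ y) (A₁ y)
  structC : pd 0 C₁ y - pd 1 C₀ y = -(2 : ℝ) • cross (C₀ y) (C₁ y)

namespace ACFrame

variable {y : E2} {A₀ A₁ C₀ C₁ : E2 → E3} {a b : ℝ}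

/-- The two Maurer–Cartan terms coincide by `ACRel.cross_eq` and cancel in the difference. -/
theorem closed (h : ACFrame y A₀ A₁ C₀ C₁) (hr : ACRel a b (A₀ y) (A₁ y) (C₀ y) (C₁ y))
    (hb : b ≠ 0) :
    pd 0 (fun z => C₁ z - A₁ z) y = pd 1 (fun z => C₀ z - A₀ z) y := by
  rw [pd_sub 0 h.diffC₁ h.diffA₁, pd_sub 1 h.diffC₀ h.diffA₀]
  have h1 := h.structA
  have h2 := h.structC
  rw [(hr.cross_eq hb).1] at h1
  rw [(hr.cross_eq hb).2] at h2
  linear_combination (norm := module) h2 - h1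

/-- Here the equal Maurer–Cartan terms add up; this is the source of the mean curvature. -/
theorem pd_add_sub (h : ACFrame y A₀ A₁ C₀ C₁) (hr : ACRel a b (A₀ y) (A₁ y) (C₀ y) (C₁ y))
    (hb : b ≠ 0) :
    pd 0 (fun z => C₁ z + A₁ z) y - pd 1 (fun z => C₀ z + A₀ z) y =
      -(4 : ℝ) • cross (C₀ y - A₀ y) (C₁ y - A₁ y) := by
  rw [pd_add 0 h.diffC₁ h.diffA₁, pd_add 1 h.diffC₀ h.diffA₀]
  have h1 := h.structA
  have h2 := h.structC
  rw [(hr.cross_eq hb).1] at h1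
  rw [(hr.cross_eq hb).2] at h2
  linear_combination (norm := module) h2 + h1

/-- Wente's equation. -/
theorem pd_add_pd (h : ACFrame y A₀ A₁ C₀ C₁)
    (hr : ∀ᶠ z in 𝓝 y, ACRel 0 1 (A₀ z) (A₁ z) (C₀ z) (C₁ z)) :
    pd 0 (fun z => C₀ z - A₀ z) y + pd 1 (fun z => C₁ z - A₁ z) y =
      -(4 / √3 : ℝ) • cross (C₀ y - A₀ y) (C₁ y - A₁ y) := by
  have h1 := h.pd_add_sub hr.self_of_nhds one_ne_zero
  -- For a = 0, b = 1 the form C + A is √3 times C − A rotated by J, so its curl is √3 times the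
  -- divergence of C − A.
  have e1 : (fun z => C₁ z + A₁ z) =ᶠ[𝓝 y] fun z => (√3 : ℝ) • (C₀ z - A₀ z) := by
    filter_upwards [hr] with z hz
    simpa using hz.add_eq
  have e0 : (fun z => C₀ z + A₀ z) =ᶠ[𝓝 y] fun z => -(√3 : ℝ) • (C₁ z - A₁ z) := by
    filter_upwards [hr] with z hz
    simpa using hz.sub_eq
  rw [pd_congr 0 e1, pd_congr 1 e0, pd_const_smul 0 _ (h.diffC₀.fun_sub h.diffA₀),
    pd_const_smul 1 _ (h.diffC₁.fun_sub h.diffA₁)] at h1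
  have h2 : pd 0 (fun z => C₀ z - A₀ z) y + pd 1 (fun z => C₁ z - A₁ z) y =
      (1 / √3 : ℝ) • ((√3 : ℝ) • pd 0 (fun z => C₀ z - A₀ z) y -
        -(√3 : ℝ) • pd 1 (fun z => C₁ z - A₁ z) y) := by
    have := sqrt_three_ne_zero
    match_scalars <;> field_simp
  rw [h2, h1, smul_smul]
  congr 1
  ring

end ACFrame

/-- The algebra behind the mean curvature of a conformal frame: `E, F, G` are the coefficients of
the first fundamental form, `l, m, n` those of the second with respect to the normal of length
`N`. -/
theorem meanCurvature_algebra {a b E F G l m n N : ℝ} (hb : 0 < b) (hE : 0 < E)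
    (hF : a * E + b * F = 0) (hG : b ^ 2 * G = E * (1 + a ^ 2)) (hN : 0 ≤ N)
    (hN2 : N ^ 2 = E * G - F ^ 2)
    (hH : √3 * ((1 + a ^ 2) / b * l + 2 * a * m + b * n) = -4 * N ^ 2) :
    (E * (N⁻¹ * n) - 2 * F * (N⁻¹ * m) + G * (N⁻¹ * l)) / (2 * (E * G - F ^ 2)) = -(2 / √3) := by
  have hb' := hb.ne'
  have hF' : F = -(a * E / b) := by field_simp; linarith
  have hG' : G = E * (1 + a ^ 2) / b ^ 2 := by field_simp; linarith
  -- The conformality relations give E G − F² = (E / b)²; positivity of b selects the root, hence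
  -- the sign of the curvature.
  have hN' : N = E / b := by
    have : N ^ 2 = (E / b) ^ 2 := by
      rw [hN2, hF', hG']
      field_simp
      ring
    exact (sq_eq_sq₀ hN (by positivity)).1 this
  have h3 := sqrt_three_ne_zero
  rw [← hN2]
  have hX : (1 + a ^ 2) / b * l + 2 * a * m + b * n = -4 * N ^ 2 / √3 := by
    field_simp at hH ⊢
    linarith
  have h1 : E * (N⁻¹ * n) - 2 * F * (N⁻¹ * m) + G * (N⁻¹ * l) =
      N⁻¹ * (E / b) * ((1 + a ^ 2) / b * l + 2 * a * m + b * n) := by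
    rw [hF', hG']
    field_simp
    ring
  rw [h1, hX, hN']
  have := hE.ne'
  field_simp
  ring

/-- The hypotheses give C₀ − A₀ ⊥ C₀ + A₀ and |C₀ + A₀|² = 3 |C₀ − A₀|². As C₀ + A₀ is −√3 times the
value of C − A at J∂₀, the values of C − A at ∂₀ and J∂₀ are orthogonal and of equal length. -/
theorem ACRel.conformal {a b : ℝ} {A₀ A₁ C₀ C₁ : E3} (h : ACRel a b A₀ A₁ C₀ C₁)
    (hA : ⟪A₀, A₀⟫ = 2 * ⟪A₀, C₀⟫) (hC : ⟪C₀, C₀⟫ = 2 * ⟪A₀, C₀⟫) :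
    a * ⟪C₀ - A₀, C₀ - A₀⟫ + b * ⟪C₀ - A₀, C₁ - A₁⟫ = 0 ∧
      b ^ 2 * ⟪C₁ - A₁, C₁ - A₁⟫ = ⟪C₀ - A₀, C₀ - A₀⟫ * (1 + a ^ 2) := by
  have h3 := sqrt_three_ne_zero
  have h33 := sqrt_three_mul_self
  have hS := h.sub_eq
  have e1 : ⟪C₀ - A₀, C₀ + A₀⟫ = 0 := by
    rw [inner_sub_left, inner_add_right, inner_add_right, real_inner_comm A₀ C₀, hA, hC]
    ring
  have e2 : ⟪C₀ + A₀, C₀ + A₀⟫ = 3 * ⟪C₀ - A₀, C₀ - A₀⟫ := by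
    rw [inner_sub_left, inner_sub_right, inner_sub_right, inner_add_left, inner_add_right,
      inner_add_right, real_inner_comm A₀ C₀, hA, hC]
    ring
  rw [hS] at e1 e2
  generalize C₀ - A₀ = X at *
  generalize C₁ - A₁ = Y at *
  simp only [inner_smul_left, inner_smul_right, inner_add_left, inner_add_right, conj_trivial,
    real_inner_comm X Y] at e1 e2
  have e1' : a * ⟪X, X⟫ + b * ⟪X, Y⟫ = 0 := by
    have : √3 * (a * ⟪X, X⟫ + b * ⟪X, Y⟫) = 0 := by linarith
    exact (mul_eq_zero.1 this).resolve_left h3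
  refine ⟨e1', ?_⟩
  have e2' : (√3 * √3) * (a ^ 2 * ⟪X, X⟫ + 2 * a * b * ⟪X, Y⟫ + b ^ 2 * ⟪Y, Y⟫) =
      3 * ⟪X, X⟫ := by
    linear_combination e2
  rw [h33] at e2'
  linear_combination (1 / 3) * e2' - 2 * a * e1'

/-- Conformal surfaces have constant mean curvature. -/
theorem ACFrame.meanCurvature_eq {y : E2} {A₀ A₁ C₀ C₁ f : E2 → E3}
    (h : ACFrame y A₀ A₁ C₀ C₁)
    (hr : ∀ᶠ z in 𝓝 y, ∃ a b : ℝ, 0 < b ∧ ACRel a b (A₀ z) (A₁ z) (C₀ z) (C₁ z))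
    (hf₀ : ∀ᶠ z in 𝓝 y, pd 0 f z = C₀ z - A₀ z) (hf₁ : ∀ᶠ z in 𝓝 y, pd 1 f z = C₁ z - A₁ z)
    (hA : ⟪A₀ y, A₀ y⟫ = 2 * ⟪A₀ y, C₀ y⟫) (hC : ⟪C₀ y, C₀ y⟫ = 2 * ⟪A₀ y, C₀ y⟫)
    (hne : C₀ y - A₀ y ≠ 0) :
    meanCurvature f y = -(2 / √3) := by
  obtain ⟨a, b, hb, hab⟩ := hr.self_of_nhds
  obtain ⟨hF, hG⟩ := hab.conformal hA hC
  have hd₀ := h.diffC₀.fun_sub h.diffA₀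
  have hd₁ := h.diffC₁.fun_sub h.diffA₁
  have hs₀ := h.diffC₀.fun_add h.diffA₀
  have hs₁ := h.diffC₁.fun_add h.diffA₁
  have hn := differentiableAt_cross hd₀ hd₁
  have hclosed := h.closed hab hb.ne'
  have hS := h.pd_add_sub hab hb.ne'
  -- the normal component of the derivative of a tangential field
  have o₀ (i : Fin 2) := inner_pd_eq_neg_of_inner_eq_zero i hd₀ hn
    (.of_forall fun z => inner_cross_self_left _ _)
  have o₁ (i : Fin 2) := inner_pd_eq_neg_of_inner_eq_zero i hd₁ hn
    (.of_forall fun z => inner_cross_self_right _ _)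
  have t₀ : ∀ a b : ℝ, ∀ X Y : E3, ⟪-(√3 : ℝ) • (a • X + b • Y), cross X Y⟫ = 0 := by
    intro a b X Y
    rw [inner_smul_left, inner_add_left, inner_smul_left, inner_smul_left,
      inner_cross_self_left, inner_cross_self_right]
    simp
  -- Eliminating C₀ + A₀ between `add_eq` and `sub_eq` shows that C₁ + A₁ is tangential.
  have s₁ : ∀ {a b : ℝ} {z : E2}, 0 < b → ACRel a b (A₀ z) (A₁ z) (C₀ z) (C₁ z) →
      C₁ z + A₁ z = (√3 * ((1 + a ^ 2) / b)) • (C₀ z - A₀ z) + (√3 * a) • (C₁ z - A₁ z) := by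
    intro a b z hb hz
    have h1 := hz.add_eq
    rw [hz.sub_eq] at h1
    have h2 : C₁ z + A₁ z = b⁻¹ • (b • (C₁ z + A₁ z)) := by
      rw [smul_smul, inv_mul_cancel₀ hb.ne', one_smul]
    rw [h2, eq_sub_of_add_eq' h1]
    have := hb.ne'
    match_scalars <;> field_simp <;> ring
  -- The coefficients a, b depend on z and are not known to be differentiable; only the tangency of
  -- C + A near y enters.
  have u₀ := inner_pd_eq_neg_of_inner_eq_zero 1 hs₀ hn (by
    filter_upwards [hr] with z ⟨a, b, hb, hz⟩
    rw [hz.sub_eq]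
    exact t₀ a b _ _)
  have u₁ := inner_pd_eq_neg_of_inner_eq_zero 0 hs₁ hn (by
    filter_upwards [hr] with z ⟨a, b, hb, hz⟩
    rw [s₁ hb hz, inner_add_left, inner_smul_left, inner_smul_left,
      inner_cross_self_left, inner_cross_self_right]
    simp)
  rw [hab.sub_eq] at u₀
  rw [s₁ hb hab] at u₁
  have p₀ : pd 0 f y = C₀ y - A₀ y := hf₀.self_of_nhds
  have p₁ : pd 1 f y = C₁ y - A₁ y := hf₁.self_of_nhds
  have p₀₀ := pd_congr 0 hf₀
  have p₁₀ := pd_congr 1 hf₀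
  have p₁₁ := pd_congr 1 hf₁
  have hSn := congrArg (fun v => ⟪v, cross (C₀ y - A₀ y) (C₁ y - A₁ y)⟫) hS
  simp only [inner_sub_left, inner_smul_left, inner_add_left, conj_trivial, neg_mul]
    at hSn u₀ u₁
  simp only [← inner_sub_left] at hSn u₀ u₁
  have q₀₀ := o₀ 0
  have q₀₁ := o₀ 1
  have q₁₀ := o₁ 0
  have q₁₁ := o₁ 1
  -- Closedness identifies the two mixed second derivatives.
  rw [hclosed] at q₁₀
  unfold meanCurvature unitNormal
  rw [p₀₀, p₁₀, p₁₁, p₀, p₁]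
  simp only [inner_smul_right]
  refine meanCurvature_algebra hb (real_inner_self_pos.2 hne) hF hG (norm_nonneg _) ?_ ?_
  · rw [← real_inner_self_eq_norm_sq, inner_cross_cross]
  · rw [← real_inner_self_eq_norm_sq]
    simp only [inner_sub_left] at *
    -- The normal part of `pd_add_sub`: u₀ and u₁ express the derivatives of C + A through those of
    -- the normal, and the q's turn these into second derivatives of f.
    linear_combination hSn - u₁ + u₀ + √3 * ((1 + a ^ 2) / b) * q₀₀ + √3 * a * q₁₀ + √3 * a * q₀₁
      + √3 * b * q₁₁

/-! ### Quaternions -/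

/-- `imVec` as a continuous linear map. -/
def imVecL : ℍ[ℝ] →L[ℝ] E3 :=
  LinearMap.toContinuousLinearMap
    { toFun := imVec
      map_add' := fun a b => by apply E3_ext <;> simp [imVec]
      map_smul' := fun c a => by apply E3_ext <;> simp [imVec] }

@[simp]
theorem imVecL_apply (a : ℍ[ℝ]) : imVecL a = imVec a := rfl

theorem imVec_add (a b : ℍ[ℝ]) : imVec (a + b) = imVec a + imVec b := imVecL.map_add a b

theorem imVec_sub (a b : ℍ[ℝ]) : imVec (a - b) = imVec a - imVec b := imVecL.map_sub a b

theorem imVec_smul (c : ℝ) (a : ℍ[ℝ]) : imVec (c • a) = c • imVec a := imVecL.map_smul c a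

theorem eq_zero_of_imVec_eq_zero {a : ℍ[ℝ]} (hr : a.re = 0) (hi : imVec a = 0) : a = 0 := by
  have h0 := congrArg (fun v : E3 => v 0) hi
  have h1 := congrArg (fun v : E3 => v 1) hi
  have h2 := congrArg (fun v : E3 => v 2) hi
  simp only [imVec] at h0 h1 h2
  ext
  exacts [hr, h0, h1, h2]

theorem inner_imVec {a b : ℍ[ℝ]} (ha : a.re = 0) : ⟪a, b⟫ = ⟪imVec a, imVec b⟫ := by
  rw [inner_E3, Quaternion.inner_def]
  simp [imVec, Quaternion.re_mul, ha]

theorem imVec_star_mul_sub {a b : ℍ[ℝ]} (ha : a.re = 0) (hb : b.re = 0) :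
    imVec (star a * b - star b * a) = -(2 : ℝ) • cross (imVec a) (imVec b) := by
  apply E3_ext <;> simp [imVec, cross_zero, cross_one, cross_two, ha, hb] <;> ring

theorem inv_eq_star {p : ℍ[ℝ]} (hp : ‖p‖ = 1) : p⁻¹ = star p := by
  rw [Quaternion.inv_def, Quaternion.normSq_eq_norm_mul_self, hp]
  simp

theorem S3.norm_eq (p : S3) : ‖(p : ℍ[ℝ])‖ = 1 := by simp

theorem S3.ne_zero (p : S3) : (p : ℍ[ℝ]) ≠ 0 := by
  intro h
  have := S3.norm_eq p
  simp [h] at this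

theorem inner_mul_left_unit {p : ℍ[ℝ]} (hp : ‖p‖ = 1) (a b : ℍ[ℝ]) : ⟪p * a, p * b⟫ = ⟪a, b⟫ := by
  have h : p.re * p.re + p.imI * p.imI + p.imJ * p.imJ + p.imK * p.imK = 1 := by
    have := Quaternion.normSq_eq_norm_mul_self p
    rw [Quaternion.normSq_def', hp] at this
    linarith
  simp only [Quaternion.inner_def, Quaternion.re_mul, Quaternion.imI_mul, Quaternion.imJ_mul,
    Quaternion.imK_mul, Quaternion.re_star, Quaternion.imI_star, Quaternion.imJ_star,
    Quaternion.imK_star]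
  linear_combination (a.re * b.re + a.imI * b.imI + a.imJ * b.imJ + a.imK * b.imK) * h

/-! ### The nearly Kähler structure in the frame of left invariant fields -/

/-- Tangent vectors of `S³ × S³`. -/
def IsTangent (m : S3 × S3) (X : ℍ[ℝ] × ℍ[ℝ]) : Prop :=
  ((m.1 : ℍ[ℝ])⁻¹ * X.1).re = 0 ∧ ((m.2 : ℍ[ℝ])⁻¹ * X.2).re = 0

/-- The component `p⁻¹ U` of `(U, V)`. -/
def lg₁ (m : S3 × S3) (X : ℍ[ℝ] × ℍ[ℝ]) : E3 := imVec ((m.1 : ℍ[ℝ])⁻¹ * X.1)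

/-- The component `q⁻¹ V` of `(U, V)`. -/
def lg₂ (m : S3 × S3) (X : ℍ[ℝ] × ℍ[ℝ]) : E3 := imVec ((m.2 : ℍ[ℝ])⁻¹ * X.2)

section Frame

variable (m : S3 × S3) (X Y : ℍ[ℝ] × ℍ[ℝ])

theorem lg₁_add : lg₁ m (X + Y) = lg₁ m X + lg₁ m Y := by
  simp [lg₁, mul_add, imVec_add]

theorem lg₂_add : lg₂ m (X + Y) = lg₂ m X + lg₂ m Y := by
  simp [lg₂, mul_add, imVec_add]

theorem lg₁_smul (c : ℝ) : lg₁ m (c • X) = c • lg₁ m X := by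
  simp [lg₁, imVec_smul]

theorem lg₂_smul (c : ℝ) : lg₂ m (c • X) = c • lg₂ m X := by
  simp [lg₂, imVec_smul]

/-- The factor p q⁻¹ in J carries the left invariant frame at q to that at p, so J has constant
coefficients on (p⁻¹U, q⁻¹V). -/
theorem inv_mul_acs_fst : (m.1 : ℍ[ℝ])⁻¹ * (acs m X).1 =
    (1 / √3 : ℝ) • ((2 : ℝ) • ((m.2 : ℍ[ℝ])⁻¹ * X.2) - (m.1 : ℍ[ℝ])⁻¹ * X.1) := by
  have h := S3.ne_zero m.1
  simp only [acs, Prod.smul_mk, mul_smul_comm, mul_sub]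
  congr 2
  rw [two_mul, two_smul, mul_add, mul_assoc, inv_mul_cancel_left₀ h]

theorem inv_mul_acs_snd : (m.2 : ℍ[ℝ])⁻¹ * (acs m X).2 =
    (1 / √3 : ℝ) • ((m.2 : ℍ[ℝ])⁻¹ * X.2 - (2 : ℝ) • ((m.1 : ℍ[ℝ])⁻¹ * X.1)) := by
  have h := S3.ne_zero m.2
  simp only [acs, Prod.smul_mk, mul_smul_comm, mul_add]
  congr 1
  rw [neg_mul, two_mul, two_smul, mul_neg, mul_add, mul_assoc, inv_mul_cancel_left₀ h]
  abel

theorem lg₁_acs : lg₁ m (acs m X) = (1 / √3 : ℝ) • ((2 : ℝ) • lg₂ m X - lg₁ m X) := by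
  simp only [lg₁, lg₂, inv_mul_acs_fst, imVec_smul, imVec_sub]

theorem lg₂_acs : lg₂ m (acs m X) = (1 / √3 : ℝ) • (lg₂ m X - (2 : ℝ) • lg₁ m X) := by
  simp only [lg₁, lg₂, inv_mul_acs_snd, imVec_smul, imVec_sub]

theorem inv_mul_aps_fst : (m.1 : ℍ[ℝ])⁻¹ * (aps m X).1 = (m.2 : ℍ[ℝ])⁻¹ * X.2 := by
  rw [aps, mul_assoc, inv_mul_cancel_left₀ (S3.ne_zero m.1)]

theorem inv_mul_aps_snd : (m.2 : ℍ[ℝ])⁻¹ * (aps m X).2 = (m.1 : ℍ[ℝ])⁻¹ * X.1 := by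
  simp only [aps]
  rw [mul_assoc, inv_mul_cancel_left₀ (S3.ne_zero m.2)]

theorem lg₁_aps : lg₁ m (aps m X) = lg₂ m X := by
  simp only [lg₁, lg₂, inv_mul_aps_fst]

theorem lg₂_aps : lg₂ m (aps m X) = lg₁ m X := by
  simp only [lg₁, lg₂, inv_mul_aps_snd]

variable {m X Y}

theorem IsTangent.map_acs (h : IsTangent m X) : IsTangent m (acs m X) := by
  constructor
  · rw [inv_mul_acs_fst]; simp [h.1, h.2]
  · rw [inv_mul_acs_snd]; simp [h.1, h.2]

theorem IsTangent.map_aps (h : IsTangent m X) : IsTangent m (aps m X) := by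
  constructor
  · rw [inv_mul_aps_fst]; exact h.2
  · rw [inv_mul_aps_snd]; exact h.1

theorem IsTangent.smul (h : IsTangent m X) (c : ℝ) : IsTangent m (c • X) := by
  constructor
  · simp [h.1]
  · simp [h.2]

theorem IsTangent.eq_zero (h : IsTangent m X) (h₁ : lg₁ m X = 0) (h₂ : lg₂ m X = 0) : X = 0 := by
  have e₁ := eq_zero_of_imVec_eq_zero h.1 h₁
  have e₂ := eq_zero_of_imVec_eq_zero h.2 h₂
  ext1
  · exact (mul_eq_zero.1 e₁).resolve_left (inv_ne_zero (S3.ne_zero m.1))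
  · exact (mul_eq_zero.1 e₂).resolve_left (inv_ne_zero (S3.ne_zero m.2))

/-- Left multiplication by a unit quaternion is an isometry. A vanishing real part in one argument
already reduces the inner product to imaginary parts. -/
theorem IsTangent.prodMetric_eq (hX : IsTangent m X) :
    prodMetric X Y = ⟪lg₁ m X, lg₁ m Y⟫ + ⟪lg₂ m X, lg₂ m Y⟫ := by
  have h₁ : ‖(m.1 : ℍ[ℝ])⁻¹‖ = 1 := by simp
  have h₂ : ‖(m.2 : ℍ[ℝ])⁻¹‖ = 1 := by simp
  rw [prodMetric, ← inner_mul_left_unit h₁ X.1, ← inner_mul_left_unit h₂ X.2,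
    inner_imVec hX.1, inner_imVec hX.2]
  rfl

theorem inner_acs_add (A C A' C' : E3) :
    ⟪(1 / √3 : ℝ) • ((2 : ℝ) • C - A), (1 / √3 : ℝ) • ((2 : ℝ) • C' - A')⟫ +
      ⟪(1 / √3 : ℝ) • (C - (2 : ℝ) • A), (1 / √3 : ℝ) • (C' - (2 : ℝ) • A')⟫ =
    1 / 3 * (5 * ⟪A, A'⟫ + 5 * ⟪C, C'⟫ - 4 * ⟪A, C'⟫ - 4 * ⟪C, A'⟫) := by
  have h : (1 / √3 : ℝ) * (1 / √3) = 1 / 3 := by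
    rw [div_mul_div_comm, sqrt_three_mul_self, one_mul]
  simp only [inner_smul_left, inner_smul_right, inner_sub_left, inner_sub_right, conj_trivial]
  linear_combination (5 * ⟪A, A'⟫ + 5 * ⟪C, C'⟫ - 4 * ⟪A, C'⟫ - 4 * ⟪C, A'⟫) * h

theorem IsTangent.nkMetric_eq (hX : IsTangent m X) :
    nkMetric m X Y = 4 / 3 * (⟪lg₁ m X, lg₁ m Y⟫ + ⟪lg₂ m X, lg₂ m Y⟫) -
      2 / 3 * (⟪lg₁ m X, lg₂ m Y⟫ + ⟪lg₂ m X, lg₁ m Y⟫) := by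
  rw [nkMetric, hX.prodMetric_eq, hX.map_acs.prodMetric_eq, lg₁_acs, lg₁_acs, lg₂_acs,
    lg₂_acs, inner_acs_add]
  ring

/-- The vanishing of the real part of the quadratic differential. -/
theorem IsTangent.inner_self_add (hX : IsTangent m X)
    (h : nkMetric m (aps m ((1 / 2 : ℝ) • X)) ((1 / 2 : ℝ) • X) -
      nkMetric m (aps m (-((1 / 2 : ℝ) • acs m X)))
        (-((1 / 2 : ℝ) • acs m X)) = 0) :
    ⟪lg₁ m X, lg₁ m X⟫ + ⟪lg₂ m X, lg₂ m X⟫ = 4 * ⟪lg₁ m X, lg₂ m X⟫ := by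
  rw [← neg_smul, (hX.smul _).map_aps.nkMetric_eq, (hX.map_acs.smul _).map_aps.nkMetric_eq] at h
  simp only [lg₁_aps, lg₂_aps, lg₁_smul, lg₂_smul, lg₁_acs, lg₂_acs, inner_smul_left,
    inner_smul_right, conj_trivial, inner_sub_left, inner_sub_right] at h
  rw [real_inner_comm (lg₁ m X) (lg₂ m X)] at h
  have h3 : (1 / √3 : ℝ) * (1 / √3) = 1 / 3 := by
    rw [div_mul_div_comm, sqrt_three_mul_self, one_mul]
  generalize (1 / √3 : ℝ) = s at *
  generalize ⟪lg₁ m X, lg₁ m X⟫ = x at *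
  generalize ⟪lg₂ m X, lg₂ m X⟫ = y at *
  generalize ⟪lg₁ m X, lg₂ m X⟫ = z at *
  have hs : s ^ 2 = 1 / 3 := by rw [sq, h3]
  ring_nf at h
  rw [hs] at h
  linarith

/-- The vanishing of the imaginary part of the quadratic differential. -/
theorem IsTangent.inner_self_eq (hX : IsTangent m X)
    (h : nkMetric m (aps m ((1 / 2 : ℝ) • X)) (-((1 / 2 : ℝ) • acs m X)) +
      nkMetric m (aps m (-((1 / 2 : ℝ) • acs m X))) ((1 / 2 : ℝ) • X) = 0) :
    ⟪lg₁ m X, lg₁ m X⟫ = ⟪lg₂ m X, lg₂ m X⟫ := by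
  rw [← neg_smul, (hX.smul _).map_aps.nkMetric_eq, (hX.map_acs.smul _).map_aps.nkMetric_eq] at h
  simp only [lg₁_aps, lg₂_aps, lg₁_smul, lg₂_smul, lg₁_acs, lg₂_acs, inner_smul_left,
    inner_smul_right, conj_trivial, inner_sub_left, inner_sub_right] at h
  rw [real_inner_comm (lg₁ m X) (lg₂ m X)] at h
  have h3 : (1 / √3 : ℝ) ≠ 0 := by positivity
  refine mul_left_cancel₀ h3 ?_
  linarith

end Frame

/-! ### The Maurer-Cartan form -/

/-- Conjugation of quaternions as a continuous linear map. -/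
def conjL : ℍ[ℝ] →L[ℝ] ℍ[ℝ] :=
  LinearMap.toContinuousLinearMap
    { toFun := star
      map_add' := star_add
      map_smul' := fun c a => by simp }

@[simp]
theorem conjL_apply (a : ℍ[ℝ]) : conjL a = star a := rfl

theorem two_le_infty : (2 : WithTop ℕ∞) ≤ ∞ :=
  WithTop.coe_le_coe.2 (le_top : (2 : ℕ∞) ≤ ⊤)

/-- The form `g⁻¹ dg`, for a map `g` into the unit quaternions. -/
def mcForm (g : E2 → ℍ[ℝ]) (y : E2) : E2 →L[ℝ] E3 :=
  imVecL ∘L (ContinuousLinearMap.mul ℝ ℍ[ℝ] (star (g y)) ∘L fderiv ℝ g y)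

theorem mcForm_apply (g : E2 → ℍ[ℝ]) (y v : E2) :
    mcForm g y v = imVec (star (g y) * fderiv ℝ g y v) := rfl

theorem contDiffOn_mcForm {g : E2 → ℍ[ℝ]} {s : Set E2} (hs : IsOpen s) (hg : ContDiffOn ℝ ∞ g s) :
    ContDiffOn ℝ ∞ (mcForm g) s := by
  have h1 : ContDiffOn ℝ ∞ (fderiv ℝ g) s := hg.fderiv_of_isOpen hs (by simp)
  have h2 : ContDiffOn ℝ ∞ (fun y => star (g y)) s :=
    conjL.contDiff.comp_contDiffOn hg
  have h3 : ContDiffOn ℝ ∞ (fun y => ContinuousLinearMap.mul ℝ ℍ[ℝ] (star (g y))) s :=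
    (ContinuousLinearMap.mul ℝ ℍ[ℝ]).contDiff.comp_contDiffOn h2
  exact contDiffOn_const.clm_comp (h3.clm_comp h1)

theorem re_star_mul_fderiv {g : E2 → ℍ[ℝ]} {y : E2} (hg : DifferentiableAt ℝ g y)
    (h1 : ∀ᶠ z in 𝓝 y, ‖g z‖ = 1) (v : E2) : (star (g y) * fderiv ℝ g y v).re = 0 := by
  have h2 : fderiv ℝ (fun z => ⟪g z, g z⟫) y = 0 := by
    have : (fun z => ⟪g z, g z⟫) =ᶠ[𝓝 y] fun _ => (1 : ℝ) := by
      filter_upwards [h1] with z hz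
      rw [real_inner_self_eq_norm_sq, hz, one_pow]
    rw [this.fderiv_eq]
    simp
  have h3 := fderiv_inner_apply ℝ hg hg v
  rw [h2, real_inner_comm (g y) (fderiv ℝ g y v)] at h3
  simp only [_root_.zero_apply, Quaternion.inner_def, Quaternion.re_mul, Quaternion.re_star,
    Quaternion.imI_star, Quaternion.imJ_star, Quaternion.imK_star] at h3 ⊢
  linarith

/-- The Maurer-Cartan equation. -/
theorem pd_mcForm_sub {g : E2 → ℍ[ℝ]} {y : E2} (hg : ContDiffAt ℝ ∞ g y)
    (h1 : ∀ᶠ z in 𝓝 y, ‖g z‖ = 1) (v w : E2) :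
    fderiv ℝ (fun z => mcForm g z w) y v - fderiv ℝ (fun z => mcForm g z v) y w =
      -(2 : ℝ) • cross (mcForm g y v) (mcForm g y w) := by
  have hd : DifferentiableAt ℝ g y := hg.differentiableAt (by simp)
  have hd2 : DifferentiableAt ℝ (fderiv ℝ g) y :=
    (hg.fderiv_right (m := 1) (by rw [one_add_one_eq_two]; exact two_le_infty)).differentiableAt (by simp)
  have key : ∀ v w : E2, fderiv ℝ (fun z => mcForm g z w) y v =
      imVec (star (g y) * fderiv ℝ (fderiv ℝ g) y v w + star (fderiv ℝ g y v) * fderiv ℝ g y w) := by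
    intro v w
    have e1 : HasFDerivAt (fun z => star (g z))
        (conjL ∘L fderiv ℝ g y) y :=
      conjL.hasFDerivAt.comp y hd.hasFDerivAt
    have e2 : HasFDerivAt (fun z => fderiv ℝ g z w)
        ((ContinuousLinearMap.apply ℝ ℍ[ℝ] w) ∘L fderiv ℝ (fderiv ℝ g) y) y :=
      (ContinuousLinearMap.apply ℝ ℍ[ℝ] w).hasFDerivAt.comp y hd2.hasFDerivAt
    have e3 := imVecL.hasFDerivAt.comp y (e1.mul' e2)
    have e4 : fderiv ℝ (fun z => mcForm g z w) y = _ := e3.fderiv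
    rw [e4]
    simp [imVec_add]
  -- The second derivatives cancel by symmetry; only the products of first derivatives survive.
  have hsymm : fderiv ℝ (fderiv ℝ g) y v w = fderiv ℝ (fderiv ℝ g) y w v :=
    hg.isSymmSndFDerivAt (by simpa using two_le_infty) v w
  have hn : ‖g y‖ = 1 := h1.self_of_nhds
  have hgg : g y * star (g y) = 1 := by
    rw [← inv_eq_star hn, mul_inv_cancel₀]
    intro h0
    simp [h0] at hn
  -- Inserting g g* = 1 rewrites these products through the imaginary values of g⁻¹dg, whose
  -- commutator is twice the cross product.
  have hst : ∀ v w, star (fderiv ℝ g y v) * fderiv ℝ g y w =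
      star (star (g y) * fderiv ℝ g y v) * (star (g y) * fderiv ℝ g y w) := by
    intro v w
    rw [star_mul, star_star, mul_assoc, ← mul_assoc (g y), hgg, one_mul]
  rw [key, key, hsymm, imVec_add, imVec_add, add_sub_add_left_eq_sub, hst, hst, ← imVec_sub,
    imVec_star_mul_sub (re_star_mul_fderiv hd h1 v) (re_star_mul_fderiv hd h1 w)]
  rfl

/-! ### Almost complex surfaces in charts -/

section Charts

variable {M : Type*} [TopologicalSpace M] [ChartedSpace E2 M] {φ : M → S3 × S3}

theorem contMDiff_ambient (h : ContMDiff (𝓡 2) ((𝓡 3).prod (𝓡 3)) ∞ φ) :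
    ContMDiff (𝓡 2) 𝓘(ℝ, ℍ[ℝ] × ℍ[ℝ]) ∞ (ambient φ) :=
  ((contMDiff_coe_sphere (n := 3)).comp h.fst).prodMk_space
    ((contMDiff_coe_sphere (n := 3)).comp h.snd)

theorem hasMFDerivAt_ambient (h : ContMDiff (𝓡 2) ((𝓡 3).prod (𝓡 3)) ∞ φ) (x : M) :
    HasMFDerivAt (𝓡 2) 𝓘(ℝ, ℍ[ℝ] × ℍ[ℝ]) (ambient φ) x (diffl φ x) :=
  ((contMDiff_ambient h).mdifferentiableAt (by simp)).hasMFDerivAt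

theorem injective_mfderiv_coe_S3 (p : S3) :
    Function.Injective (mfderiv (𝓡 3) 𝓘(ℝ, ℍ[ℝ]) ((↑) : S3 → ℍ[ℝ]) p) :=
  injective_mvfderiv_subtypeVal_sphere (n := 3) p

/-- Both components of dφ, computed intrinsically and then included in ℍ, agree with those of
`diffl` by uniqueness of derivatives, and the inclusion of S³ is an immersion. -/
theorem injective_diffl (h : IsSmoothImmersion ((𝓡 3).prod (𝓡 3)) φ) (x : M) :
    Function.Injective (diffl φ x) := by
  have hd : HasMFDerivAt (𝓡 2) ((𝓡 3).prod (𝓡 3)) φ x _ :=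
    (h.1.mdifferentiableAt (x := x) (by simp)).hasMFDerivAt
  have hc (p : S3) : HasMFDerivAt (𝓡 3) 𝓘(ℝ, ℍ[ℝ]) ((↑) : S3 → ℍ[ℝ]) p _ :=
    ((contMDiff_coe_sphere (n := 3) (m := ∞)).mdifferentiableAt (x := p) (by simp)).hasMFDerivAt
  have h1 := (hc (φ x).1).comp x ((hasMFDerivAt_fst (φ x)).comp x hd)
  have h2 := (hc (φ x).2).comp x ((hasMFDerivAt_snd (φ x)).comp x hd)
  have ha := hasMFDerivAt_ambient h.1 x
  have h1' := hasMFDerivAt_unique h1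
    ((ContinuousLinearMap.fst ℝ ℍ[ℝ] ℍ[ℝ]).hasMFDerivAt.comp x ha)
  have h2' := hasMFDerivAt_unique h2
    ((ContinuousLinearMap.snd ℝ ℍ[ℝ] ℍ[ℝ]).hasMFDerivAt.comp x ha)
  intro v w hvw
  apply h.2 x
  have e1 := (DFunLike.congr_fun h1' v).trans ((congrArg Prod.fst hvw).trans
    (DFunLike.congr_fun h1' w).symm)
  have e2 := (DFunLike.congr_fun h2' v).trans ((congrArg Prod.snd hvw).trans
    (DFunLike.congr_fun h2' w).symm)
  exact Prod.ext (injective_mfderiv_coe_S3 _ e1) (injective_mfderiv_coe_S3 _ e2)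

/-- The form `q⁻¹ dq - p⁻¹ dp`. -/
def diffForm (φ : M → S3 × S3) (x : M) : TangentSpace (𝓡 2) x →L[ℝ] E3 :=
  (imVecL ∘L (ContinuousLinearMap.mul ℝ ℍ[ℝ] ((φ x).2 : ℍ[ℝ])⁻¹ ∘L
      ContinuousLinearMap.snd ℝ ℍ[ℝ] ℍ[ℝ]) -
    imVecL ∘L (ContinuousLinearMap.mul ℝ ℍ[ℝ] ((φ x).1 : ℍ[ℝ])⁻¹ ∘L
      ContinuousLinearMap.fst ℝ ℍ[ℝ] ℍ[ℝ])) ∘L diffl φ x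

theorem diffForm_apply (x : M) (v : TangentSpace (𝓡 2) x) :
    diffForm φ x v = lg₂ (φ x) (diffl φ x v) - lg₁ (φ x) (diffl φ x v) := rfl

/-- The form `p⁻¹ dp` in the chart `e`. -/
def mc₁ (φ : M → S3 × S3) (e : OpenPartialHomeomorph M E2) : E2 → E2 →L[ℝ] E3 :=
  mcForm fun z => (ambient φ (e.symm z)).1

/-- The form `q⁻¹ dq` in the chart `e`. -/
def mc₂ (φ : M → S3 × S3) (e : OpenPartialHomeomorph M E2) : E2 → E2 →L[ℝ] E3 :=
  mcForm fun z => (ambient φ (e.symm z)).2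

variable {e : OpenPartialHomeomorph M E2} {y : E2}

theorem contDiffOn_ambient_comp_symm (h : ContMDiff (𝓡 2) ((𝓡 3).prod (𝓡 3)) ∞ φ)
    (he : e ∈ IsManifold.maximalAtlas (𝓡 2) ∞ M) :
    ContDiffOn ℝ ∞ (ambient φ ∘ e.symm) e.target :=
  contMDiffOn_iff_contDiffOn.1
    ((contMDiff_ambient h).comp_contMDiffOn (contMDiffOn_symm_of_mem_maximalAtlas he))

theorem contDiffOn_mc₁ (h : ContMDiff (𝓡 2) ((𝓡 3).prod (𝓡 3)) ∞ φ)
    (he : e ∈ IsManifold.maximalAtlas (𝓡 2) ∞ M) : ContDiffOn ℝ ∞ (mc₁ φ e) e.target :=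
  contDiffOn_mcForm e.open_target (contDiffOn_ambient_comp_symm h he).fst

theorem contDiffOn_mc₂ (h : ContMDiff (𝓡 2) ((𝓡 3).prod (𝓡 3)) ∞ φ)
    (he : e ∈ IsManifold.maximalAtlas (𝓡 2) ∞ M) : ContDiffOn ℝ ∞ (mc₂ φ e) e.target :=
  contDiffOn_mcForm e.open_target (contDiffOn_ambient_comp_symm h he).snd

theorem differentiableAt_ambient_comp_symm (h : ContMDiff (𝓡 2) ((𝓡 3).prod (𝓡 3)) ∞ φ)
    (he : e ∈ IsManifold.maximalAtlas (𝓡 2) ∞ M) (hy : y ∈ e.target) :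
    DifferentiableAt ℝ (ambient φ ∘ e.symm) y :=
  ((contDiffOn_ambient_comp_symm h he).contDiffAt (e.open_target.mem_nhds hy)).differentiableAt
    (by simp)

theorem mc₁_apply (h : ContMDiff (𝓡 2) ((𝓡 3).prod (𝓡 3)) ∞ φ)
    (he : e ∈ IsManifold.maximalAtlas (𝓡 2) ∞ M) (hy : y ∈ e.target) (v : E2) :
    mc₁ φ e y v = lg₁ (φ (e.symm y)) (fderiv ℝ (ambient φ ∘ e.symm) y v) := by
  have hd := differentiableAt_ambient_comp_symm h he hy
  have h1 : HasFDerivAt (fun z => (ambient φ (e.symm z)).1)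
      (ContinuousLinearMap.fst ℝ ℍ[ℝ] ℍ[ℝ] ∘L fderiv ℝ (ambient φ ∘ e.symm) y) y :=
    hd.hasFDerivAt.fst
  rw [mc₁, mcForm_apply, h1.fderiv, lg₁, inv_eq_star (S3.norm_eq _)]
  rfl

theorem mc₂_apply (h : ContMDiff (𝓡 2) ((𝓡 3).prod (𝓡 3)) ∞ φ)
    (he : e ∈ IsManifold.maximalAtlas (𝓡 2) ∞ M) (hy : y ∈ e.target) (v : E2) :
    mc₂ φ e y v = lg₂ (φ (e.symm y)) (fderiv ℝ (ambient φ ∘ e.symm) y v) := by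
  have hd := differentiableAt_ambient_comp_symm h he hy
  have h1 : HasFDerivAt (fun z => (ambient φ (e.symm z)).2)
      (ContinuousLinearMap.snd ℝ ℍ[ℝ] ℍ[ℝ] ∘L fderiv ℝ (ambient φ ∘ e.symm) y) y :=
    hd.hasFDerivAt.snd
  rw [mc₂, mcForm_apply, h1.fderiv, lg₂, inv_eq_star (S3.norm_eq _)]
  rfl

theorem isTangent_fderiv (h : ContMDiff (𝓡 2) ((𝓡 3).prod (𝓡 3)) ∞ φ)
    (he : e ∈ IsManifold.maximalAtlas (𝓡 2) ∞ M) (hy : y ∈ e.target) (v : E2) :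
    IsTangent (φ (e.symm y)) (fderiv ℝ (ambient φ ∘ e.symm) y v) := by
  have hd := differentiableAt_ambient_comp_symm h he hy
  have h1 : HasFDerivAt (fun z => (ambient φ (e.symm z)).1)
      (ContinuousLinearMap.fst ℝ ℍ[ℝ] ℍ[ℝ] ∘L fderiv ℝ (ambient φ ∘ e.symm) y) y :=
    hd.hasFDerivAt.fst
  have h2 : HasFDerivAt (fun z => (ambient φ (e.symm z)).2)
      (ContinuousLinearMap.snd ℝ ℍ[ℝ] ℍ[ℝ] ∘L fderiv ℝ (ambient φ ∘ e.symm) y) y :=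
    hd.hasFDerivAt.snd
  have r1 := re_star_mul_fderiv h1.differentiableAt (.of_forall fun z => S3.norm_eq _) v
  have r2 := re_star_mul_fderiv h2.differentiableAt (.of_forall fun z => S3.norm_eq _) v
  rw [h1.fderiv] at r1
  rw [h2.fderiv] at r2
  constructor
  · rw [inv_eq_star (S3.norm_eq _)]; exact r1
  · rw [inv_eq_star (S3.norm_eq _)]; exact r2

theorem fderiv_ambient_comp_symm (h : ContMDiff (𝓡 2) ((𝓡 3).prod (𝓡 3)) ∞ φ)
    (he : e ∈ IsManifold.maximalAtlas (𝓡 2) ∞ M) (hy : y ∈ e.target) (v : E2) :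
    fderiv ℝ (ambient φ ∘ e.symm) y v =
      diffl φ (e.symm y) (mfderiv (𝓡 2) (𝓡 2) e.symm y v) := by
  exact fderiv_comp_symm_apply he hy (hasMFDerivAt_ambient h _) v

theorem mdifferentiable_of_mem_maximalAtlas (he : e ∈ IsManifold.maximalAtlas (𝓡 2) ∞ M) :
    e.MDifferentiable (𝓡 2) (𝓡 2) :=
  ⟨(contMDiffOn_of_mem_maximalAtlas he).mdifferentiableOn (by simp),
    (contMDiffOn_symm_of_mem_maximalAtlas he).mdifferentiableOn (by simp)⟩

theorem bijective_mfderiv_symm (he : e ∈ IsManifold.maximalAtlas (𝓡 2) ∞ M) (hy : y ∈ e.target) :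
    Function.Bijective (mfderiv (𝓡 2) (𝓡 2) e.symm y) :=
  (mdifferentiable_of_mem_maximalAtlas he).symm.mfderiv_bijective hy

theorem mfderiv_symm_single_ne_zero (he : e ∈ IsManifold.maximalAtlas (𝓡 2) ∞ M)
    (hy : y ∈ e.target) (i : Fin 2) :
    mfderiv (𝓡 2) (𝓡 2) e.symm y (EuclideanSpace.single i (1 : ℝ) : E2) ≠ 0 := by
  intro h
  have h2 := (bijective_mfderiv_symm he hy).1
    (h.trans (map_zero (mfderiv (𝓡 2) (𝓡 2) e.symm y)).symm)
  have h3 : (EuclideanSpace.single i (1 : ℝ) : E2) i = (0 : E2) i := congrArg (fun v : E2 => v i) h2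
  simp at h3

theorem exists_mfderiv_symm_eq (he : e ∈ IsManifold.maximalAtlas (𝓡 2) ∞ M) (hy : y ∈ e.target)
    (v : TangentSpace (𝓡 2) (e.symm y)) : ∃ u : E2, mfderiv (𝓡 2) (𝓡 2) e.symm y u = v :=
  (bijective_mfderiv_symm he hy).2 v

theorem exists_chart [IsManifold (𝓡 2) ∞ M] (x : M) : ∃ e ∈ IsManifold.maximalAtlas (𝓡 2) ∞ M, ∃ y ∈ e.target,
    (OpenPartialHomeomorph.symm e : E2 → M) y = x :=
  ⟨chartAt E2 x, IsManifold.chart_mem_maximalAtlas x, chartAt E2 x x, mem_chart_target E2 x,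
    (chartAt E2 x).left_inv (mem_chart_source E2 x)⟩

theorem isTangent_diffl [IsManifold (𝓡 2) ∞ M] (h : ContMDiff (𝓡 2) ((𝓡 3).prod (𝓡 3)) ∞ φ) (x : M)
    (v : TangentSpace (𝓡 2) x) : IsTangent (φ x) (diffl φ x v) := by
  obtain ⟨e, he, y, hy, rfl⟩ := exists_chart x
  obtain ⟨u, rfl⟩ := exists_mfderiv_symm_eq he hy v
  rw [← fderiv_ambient_comp_symm h he hy]
  exact isTangent_fderiv h he hy u

theorem diffForm_comp_mfderiv (h : ContMDiff (𝓡 2) ((𝓡 3).prod (𝓡 3)) ∞ φ)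
    (he : e ∈ IsManifold.maximalAtlas (𝓡 2) ∞ M) (hy : y ∈ e.target) (v : E2) :
    diffForm φ (e.symm y) (mfderiv (𝓡 2) (𝓡 2) e.symm y v) = mc₂ φ e y v - mc₁ φ e y v := by
  rw [diffForm_apply, mc₁_apply h he hy, mc₂_apply h he hy, fderiv_ambient_comp_symm h he hy]

theorem acFrame_mc (h : ContMDiff (𝓡 2) ((𝓡 3).prod (𝓡 3)) ∞ φ)
    (he : e ∈ IsManifold.maximalAtlas (𝓡 2) ∞ M) (hy : y ∈ e.target) :
    ACFrame y (fun z => mc₁ φ e z (EuclideanSpace.single 0 1))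
      (fun z => mc₁ φ e z (EuclideanSpace.single 1 1))
      (fun z => mc₂ φ e z (EuclideanSpace.single 0 1))
      (fun z => mc₂ φ e z (EuclideanSpace.single 1 1)) := by
  have hn := e.open_target.mem_nhds hy
  have d1 : DifferentiableAt ℝ (mc₁ φ e) y :=
    ((contDiffOn_mc₁ h he).contDiffAt hn).differentiableAt (by simp)
  have d2 : DifferentiableAt ℝ (mc₂ φ e) y :=
    ((contDiffOn_mc₂ h he).contDiffAt hn).differentiableAt (by simp)
  have hA := (contDiffOn_ambient_comp_symm h he).contDiffAt hn
  exact
    { diffA₀ := d1.clm_apply (differentiableAt_const _)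
      diffA₁ := d1.clm_apply (differentiableAt_const _)
      diffC₀ := d2.clm_apply (differentiableAt_const _)
      diffC₁ := d2.clm_apply (differentiableAt_const _)
      structA := pd_mcForm_sub hA.fst (.of_forall fun z => S3.norm_eq _) _ _
      structC := pd_mcForm_sub hA.snd (.of_forall fun z => S3.norm_eq _) _ _ }

theorem acRel_mc (h : ContMDiff (𝓡 2) ((𝓡 3).prod (𝓡 3)) ∞ φ)
    (he : e ∈ IsManifold.maximalAtlas (𝓡 2) ∞ M) (hy : y ∈ e.target) {a b : ℝ}
    (hJ : acs (φ (e.symm y)) (pd 0 (ambient φ ∘ e.symm) y) =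
      a • pd 0 (ambient φ ∘ e.symm) y + b • pd 1 (ambient φ ∘ e.symm) y) :
    ACRel a b (mc₁ φ e y (EuclideanSpace.single 0 1)) (mc₁ φ e y (EuclideanSpace.single 1 1))
      (mc₂ φ e y (EuclideanSpace.single 0 1)) (mc₂ φ e y (EuclideanSpace.single 1 1)) := by
  have h1 := congrArg (lg₁ (φ (e.symm y))) hJ
  have h2 := congrArg (lg₂ (φ (e.symm y))) hJ
  rw [lg₁_acs, lg₁_add, lg₁_smul, lg₁_smul] at h1
  rw [lg₂_acs, lg₂_add, lg₂_smul, lg₂_smul] at h2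
  constructor <;> simp only [mc₁_apply h he hy, mc₂_apply h he hy]
  exacts [h1, h2]

/-- A tangent vector is not a multiple of its image under `J`. -/
theorem IsTangent.eq_zero_of_acs_eq_smul {m : S3 × S3} {X : ℍ[ℝ] × ℍ[ℝ]} (hX : IsTangent m X)
    {a : ℝ} (h : acs m X = a • X) : X = 0 := by
  have h1 := congrArg (lg₁ m) h
  have h2 := congrArg (lg₂ m) h
  rw [lg₁_acs, lg₁_smul] at h1
  rw [lg₂_acs, lg₂_smul] at h2
  have h3 := sqrt_three_ne_zero
  have h33 := sqrt_three_mul_self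
  have hC : lg₂ m X = ((√3 * a + 1) / 2) • lg₁ m X := by
    have : lg₂ m X = (√3 / 2 : ℝ) • (1 / √3 : ℝ) • ((2 : ℝ) • lg₂ m X - lg₁ m X) +
        (1 / 2 : ℝ) • lg₁ m X := by
      match_scalars <;> field_simp
      ring
    rw [this, h1]
    module
  -- Eliminating `lg₂` leaves the factor −(√3/2)(a² + 1), which is nonzero: J has no real
  -- eigenvalue.
  have hz : lg₁ m X = 0 := by
    have h4 : ((1 / √3) * ((√3 * a + 1) / 2 - 2) - a * ((√3 * a + 1) / 2)) • lg₁ m X = 0 := by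
      rw [hC] at h2
      linear_combination (norm := module) h2
    refine (smul_eq_zero.1 h4).resolve_left ?_
    have : (1 / √3) * ((√3 * a + 1) / 2 - 2) - a * ((√3 * a + 1) / 2) =
        -(√3 / 2) * (a ^ 2 + 1) := by
      field_simp
      linear_combination h33
    rw [this]
    have : 0 < a ^ 2 + 1 := by positivity
    simp [this.ne', h3]
  refine hX.eq_zero hz ?_
  rw [hC, hz, smul_zero]

/-- J-invariance supplies the coordinates a, b of J∂₀; b = 0 would make ∂₀ an eigenvector of J. The
sign of b depends on the orientation of the chart, and closedness does not need it. -/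
theorem exists_acRel (hφ : IsAlmostComplexSurface φ)
    (he : e ∈ IsManifold.maximalAtlas (𝓡 2) ∞ M) (hy : y ∈ e.target) :
    ∃ a b : ℝ, b ≠ 0 ∧
      ACRel a b (mc₁ φ e y (EuclideanSpace.single 0 1)) (mc₁ φ e y (EuclideanSpace.single 1 1))
        (mc₂ φ e y (EuclideanSpace.single 0 1)) (mc₂ φ e y (EuclideanSpace.single 1 1)) := by
  have h := hφ.1.1
  obtain ⟨w, hw⟩ := hφ.2 (e.symm y) (mfderiv (𝓡 2) (𝓡 2) e.symm y (EuclideanSpace.single 0 1))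
  obtain ⟨u, rfl⟩ := exists_mfderiv_symm_eq he hy w
  rw [← fderiv_ambient_comp_symm h he hy, ← fderiv_ambient_comp_symm h he hy] at hw
  have hu := E2_eq u
  rw [hu, map_add, map_smul, map_smul] at hw
  refine ⟨u 0, u 1, ?_, acRel_mc h he hy hw.symm⟩
  intro hb
  rw [hb, zero_smul, add_zero] at hw
  have h0 := (isTangent_fderiv h he hy _).eq_zero_of_acs_eq_smul hw.symm
  rw [fderiv_ambient_comp_symm h he hy, ← map_zero (diffl φ (e.symm y))] at h0
  exact mfderiv_symm_single_ne_zero he hy 0 (injective_diffl hφ.1 _ h0)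

end Charts

/-! ### Existence and smoothness of the primitive of q⁻¹dq − p⁻¹dp -/

section Existence

variable {M : Type*} [TopologicalSpace M] [ChartedSpace E2 M] {φ : M → S3 × S3}
  {e : OpenPartialHomeomorph M E2} {y : E2}

theorem contDiffOn_mc_sub (h : ContMDiff (𝓡 2) ((𝓡 3).prod (𝓡 3)) ∞ φ)
    (he : e ∈ IsManifold.maximalAtlas (𝓡 2) ∞ M) :
    ContDiffOn ℝ ∞ (fun z => mc₂ φ e z - mc₁ φ e z) e.target :=
  (contDiffOn_mc₂ h he).sub (contDiffOn_mc₁ h he)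

/-- Closedness on the pair (∂₀, ∂₁), extended by bilinearity to the symmetry that the Poincaré lemma
asks for. -/
theorem fderiv_mc_sub_symm (hφ : IsAlmostComplexSurface φ)
    (he : e ∈ IsManifold.maximalAtlas (𝓡 2) ∞ M) (hy : y ∈ e.target) (v w : E2) :
    fderiv ℝ (fun z => mc₂ φ e z - mc₁ φ e z) y v w =
      fderiv ℝ (fun z => mc₂ φ e z - mc₁ φ e z) y w v := by
  obtain ⟨a, b, hb, hr⟩ := exists_acRel hφ he hy
  have hc := (acFrame_mc hφ.1.1 he hy).closed hr hb
  have hd : DifferentiableAt ℝ (fun z => mc₂ φ e z - mc₁ φ e z) y :=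
    ((contDiffOn_mc_sub hφ.1.1 he).contDiffAt (e.open_target.mem_nhds hy)).differentiableAt
      (by simp)
  have key : ∀ v w : E2, fderiv ℝ (fun z => mc₂ φ e z w - mc₁ φ e z w) y v =
      fderiv ℝ (fun z => mc₂ φ e z - mc₁ φ e z) y v w := by
    intro v w
    have h1 := ((ContinuousLinearMap.apply ℝ E3 w).hasFDerivAt.comp y hd.hasFDerivAt).fderiv
    exact DFunLike.congr_fun h1 v
  simp only [pd, key] at hc
  rw [E2_eq v, E2_eq w]
  simp only [map_add, map_smul, _root_.add_apply, _root_.smul_apply, smul_add, hc]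
  module

theorem exists_local_primitive [IsManifold (𝓡 2) ∞ M] (hφ : IsAlmostComplexSurface φ) (x : M) :
    ∃ U : Set M, IsOpen U ∧ x ∈ U ∧ ∃ f : M → E3,
      ∀ y ∈ U, HasMFDerivAt (𝓡 2) 𝓘(ℝ, E3) f y (diffForm φ y) := by
  have h := hφ.1.1
  have he := IsManifold.chart_mem_maximalAtlas (I := 𝓡 2) (n := ∞) x
  set e := chartAt E2 x
  have hx : x ∈ e.source := mem_chart_source E2 x
  obtain ⟨r, hr, hball⟩ := Metric.isOpen_iff.1 e.open_target (e x) (e.map_source hx)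
  -- Poincaré lemma on a ball inside the chart.
  obtain ⟨f, hf⟩ := (convex_ball (e x) r).exists_forall_hasFDerivAt_of_fderiv_symmetric
    Metric.isOpen_ball (((contDiffOn_mc_sub h he).mono hball).differentiableOn (by simp))
    (fun a ha v w => fderiv_mc_sub_symm hφ he (hball ha) v w)
  refine ⟨e.source ∩ e ⁻¹' Metric.ball (e x) r, e.isOpen_inter_preimage Metric.isOpen_ball,
    ⟨hx, Metric.mem_ball_self hr⟩, f ∘ e, fun y hy => ?_⟩
  refine hasMFDerivAt_comp_chart he hy.1 (hf (e y) hy.2) fun v => ?_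
  have hy' : e y ∈ e.target := e.map_source hy.1
  have hinv := DFunLike.congr_fun
    ((mdifferentiable_of_mem_maximalAtlas he).symm_comp_deriv hy.1) v
  have h2 := diffForm_comp_mfderiv h he hy' (mfderiv (𝓡 2) (𝓡 2) e y v)
  -- The tangent spaces at `e.symm (e y)` and at y agree only after rewriting the base point.
  have hcast : ∀ x' : M, x' = y → ∀ w : E2, diffForm φ x' w = diffForm φ y w := by
    rintro _ rfl _
    rfl
  have h3 := (hcast _ (e.left_inv hy.1)
    (mfderiv (𝓡 2) (𝓡 2) e.symm (e y) (mfderiv (𝓡 2) (𝓡 2) e y v))).trans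
    (congrArg (diffForm φ y) hinv)
  exact h3.symm.trans h2

theorem pd_comp_symm_of_hasMFDerivAt (h : ContMDiff (𝓡 2) ((𝓡 3).prod (𝓡 3)) ∞ φ)
    {ε : M → E3} (hε : ∀ x, HasMFDerivAt (𝓡 2) 𝓘(ℝ, E3) ε x (diffForm φ x))
    (he : e ∈ IsManifold.maximalAtlas (𝓡 2) ∞ M) (hy : y ∈ e.target) (i : Fin 2) :
    pd i (ε ∘ e.symm) y =
      mc₂ φ e y (EuclideanSpace.single i 1) - mc₁ φ e y (EuclideanSpace.single i 1) := by
  rw [pd, fderiv_comp_symm_apply he hy (hε _), diffForm_comp_mfderiv h he hy]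

/-- In a chart the derivative of ε is the smooth form `mc₂ - mc₁`, so ε is smooth. -/
theorem contMDiff_of_hasMFDerivAt [IsManifold (𝓡 2) ∞ M]
    (h : ContMDiff (𝓡 2) ((𝓡 3).prod (𝓡 3)) ∞ φ)
    {ε : M → E3} (hε : ∀ x, HasMFDerivAt (𝓡 2) 𝓘(ℝ, E3) ε x (diffForm φ x)) :
    ContMDiff (𝓡 2) 𝓘(ℝ, E3) ∞ ε := by
  intro x
  have he := IsManifold.chart_mem_maximalAtlas (I := 𝓡 2) (n := ∞) x
  set e := chartAt E2 x
  have hx : x ∈ e.source := mem_chart_source E2 x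
  have hd : ∀ y ∈ e.target, HasFDerivAt (ε ∘ e.symm) (mc₂ φ e y - mc₁ φ e y) y := by
    intro y hy
    obtain ⟨D, hD, hDv⟩ := exists_hasFDerivAt_comp_symm he hy (hε _)
    refine hD.congr_fderiv (ContinuousLinearMap.ext fun v => ?_)
    rw [hDv, diffForm_comp_mfderiv h he hy]
    rfl
  have hs : ContDiffOn ℝ ∞ (ε ∘ e.symm) e.target := by
    refine (contDiffOn_infty_iff_fderiv_of_isOpen e.open_target).2
      ⟨fun y hy => (hd y hy).differentiableAt.differentiableWithinAt, ?_⟩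
    exact (contDiffOn_mc_sub h he).congr fun y hy => (hd y hy).fderiv
  have h1 : ContMDiffAt (𝓡 2) 𝓘(ℝ, E3) ∞ (ε ∘ e.symm) (e x) :=
    (hs.contDiffAt (e.open_target.mem_nhds (e.map_source hx))).contMDiffAt
  have h2 : ContMDiffAt (𝓡 2) (𝓡 2) ∞ e x :=
    (contMDiffOn_of_mem_maximalAtlas he).contMDiffAt (e.open_source.mem_nhds hx)
  refine (h1.comp x h2).congr_of_eventuallyEq ?_
  filter_upwards [e.open_source.mem_nhds hx] with z hz
  simp [e.left_inv hz]

end Existence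

/-! ### Vanishing quadratic differential -/

section Vanishing

variable {M : Type*} [TopologicalSpace M] [ChartedSpace E2 M] [IsManifold (𝓡 2) ∞ M]
  {φ : M → S3 × S3}

theorem inner_lg_of_holDiff_eq_zero (h : ContMDiff (𝓡 2) ((𝓡 3).prod (𝓡 3)) ∞ φ)
    {x : M} {v : TangentSpace (𝓡 2) x} (hΛ : holDiff φ x v = 0) :
    ⟪lg₁ (φ x) (diffl φ x v), lg₁ (φ x) (diffl φ x v)⟫ =
        2 * ⟪lg₁ (φ x) (diffl φ x v), lg₂ (φ x) (diffl φ x v)⟫ ∧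
      ⟪lg₂ (φ x) (diffl φ x v), lg₂ (φ x) (diffl φ x v)⟫ =
        2 * ⟪lg₁ (φ x) (diffl φ x v), lg₂ (φ x) (diffl φ x v)⟫ := by
  have hT := isTangent_diffl h x v
  have h1 := hT.inner_self_add (congrArg Complex.re hΛ)
  have h2 := hT.inner_self_eq (congrArg Complex.im hΛ)
  constructor <;> linarith

/-- Polarizing |A|² = |C|² = 2⟨A, C⟩ gives ⟨A, A'⟩ = ⟨C, C'⟩ = ⟨A, C'⟩ + ⟨C, A'⟩, and both sides
equal this number. -/
theorem inner_diffForm (h : ContMDiff (𝓡 2) ((𝓡 3).prod (𝓡 3)) ∞ φ) {x : M}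
    (hΛ : ∀ v : TangentSpace (𝓡 2) x, holDiff φ x v = 0) (v w : TangentSpace (𝓡 2) x) :
    ⟪diffForm φ x v, diffForm φ x w⟫ =
      (1 / 2) * nkMetric (φ x) (diffl φ x v) (diffl φ x w) := by
  rw [(isTangent_diffl h x v).nkMetric_eq, diffForm_apply, diffForm_apply]
  have h1 := inner_lg_of_holDiff_eq_zero h (hΛ v)
  have h2 := inner_lg_of_holDiff_eq_zero h (hΛ w)
  have h3 := inner_lg_of_holDiff_eq_zero h (hΛ (v + w))
  rw [map_add, lg₁_add, lg₂_add] at h3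
  generalize lg₁ (φ x) (diffl φ x v) = A at *
  generalize lg₂ (φ x) (diffl φ x v) = C at *
  generalize lg₁ (φ x) (diffl φ x w) = A' at *
  generalize lg₂ (φ x) (diffl φ x w) = C' at *
  simp only [inner_add_left, inner_add_right, inner_sub_left, inner_sub_right] at h3 ⊢
  rw [real_inner_comm A A', real_inner_comm C C', real_inner_comm C A'] at h3
  linarith [h1.1, h1.2, h2.1, h2.2, h3.1, h3.2]

/-- If A(v) = C(v), then |A(v)|² = 2 |A(v)|², so both vanish, and dφ is injective. -/
theorem diffForm_eq_zero (hφ : IsSmoothImmersion ((𝓡 3).prod (𝓡 3)) φ) {x : M}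
    {v : TangentSpace (𝓡 2) x} (hΛ : holDiff φ x v = 0) (hv : diffForm φ x v = 0) : v = 0 := by
  obtain ⟨h1, h2⟩ := inner_lg_of_holDiff_eq_zero hφ.1 hΛ
  rw [diffForm_apply, sub_eq_zero] at hv
  rw [hv] at h1 h2
  have h3 : lg₁ (φ x) (diffl φ x v) = 0 := inner_self_eq_zero.1 (by linarith : _ = (0 : ℝ))
  have h4 := (isTangent_diffl hφ.1 x v).eq_zero h3 (hv.trans h3)
  exact injective_diffl hφ x (h4.trans (map_zero _).symm)

end Vanishing

theorem ACRel.tilde_eq {A₀ A₁ C₀ C₁ : E3} (h : ACRel 0 1 A₀ A₁ C₀ C₁) :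
    C₀ - A₀ = (-(1 / 2) : ℝ) • A₀ + (√3 / 2 : ℝ) • A₁ ∧
      C₁ - A₁ = (-(√3 / 2) : ℝ) • A₀ + (-(1 / 2) : ℝ) • A₁ := by
  obtain ⟨h1, h2⟩ := h.snd_eq one_ne_zero
  have h3 := sqrt_three_ne_zero
  have h33 : (√3 : ℝ) ^ 2 = 3 := by rw [sq, sqrt_three_mul_self]
  rw [h1, h2]
  constructor
  · match_scalars <;> field_simp
    norm_num
  · match_scalars <;> field_simp <;> norm_num [h33]

end NearlyKaehlerS3

end

/-! ### The main theorem -/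

open NearlyKaehlerS3
theorem mainTheorem3 {M : Type*} [TopologicalSpace M] [ChartedSpace E2 M]
    [IsManifold (𝓡 2) ∞ M] [SimplyConnectedSpace M]
    (φ : M → S3 × S3) (hφ : IsAlmostComplexSurface φ)
    (hΛ : ∀ (x : M) (v : TangentSpace (𝓡 2) x), holDiff φ x v = 0) :
    ∃ ε : M → E3,
      -- `ε` is an immersion
      IsSmoothImmersion 𝓘(ℝ, E3) ε ∧
      -- in all coordinates with `J φ_u = φ_v` one has `ε_u = α̃`, `ε_v = β̃`
      (∀ e : OpenPartialHomeomorph M E2, IsIsothermal φ e → ∀ y ∈ e.target,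
        pd 0 (ε ∘ e.symm) y = alphaTilde φ e y ∧ pd 1 (ε ∘ e.symm) y = betaTilde φ e y) ∧
      -- the same without coordinates
      (∀ (x : M) (v w : TangentSpace (𝓡 2) x), diffl φ x w = acs (φ x) (diffl φ x v) →
        diffl3 ε x v = (-(1 / 2) : ℝ) • logDiff φ x v + (√3 / 2 : ℝ) • logDiff φ x w) ∧
      -- the `H`-surface equation
      (∀ e : OpenPartialHomeomorph M E2, IsIsothermal φ e → ∀ y ∈ e.target,
        pd 0 (pd 0 (ε ∘ e.symm)) y + pd 1 (pd 1 (ε ∘ e.symm)) y =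
          (-(4 / √3) : ℝ) • cross (pd 0 (ε ∘ e.symm) y) (pd 1 (ε ∘ e.symm) y)) ∧
      -- the mean curvature is constant
      (∀ e : OpenPartialHomeomorph M E2, IsPositiveChart φ e → ∀ y ∈ e.target,
        meanCurvature (ε ∘ e.symm) y = -(2 / √3)) ∧
      -- the induced metric is half of that of the almost complex surface
      (∀ (x : M) (v w : TangentSpace (𝓡 2) x),
        (⟪diffl3 ε x v, diffl3 ε x w⟫ : ℝ) =
          (1 / 2) * nkMetric (φ x) (diffl φ x v) (diffl φ x w)) := by
  have h := hφ.1.1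
  obtain ⟨ε, hε⟩ := exists_primitive (diffForm φ) (exists_local_primitive hφ)
  have hpd : ∀ {e : OpenPartialHomeomorph M E2}, e ∈ IsManifold.maximalAtlas (𝓡 2) ∞ M →
      ∀ y ∈ e.target, ∀ i, pd i (ε ∘ e.symm) y =
        mc₂ φ e y (EuclideanSpace.single i 1) - mc₁ φ e y (EuclideanSpace.single i 1) :=
    fun he y hy i => pd_comp_symm_of_hasMFDerivAt h hε he hy i
  have hiso : ∀ {e : OpenPartialHomeomorph M E2}, IsIsothermal φ e → ∀ y ∈ e.target,
      ACRel 0 1 (mc₁ φ e y (EuclideanSpace.single 0 1)) (mc₁ φ e y (EuclideanSpace.single 1 1))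
        (mc₂ φ e y (EuclideanSpace.single 0 1)) (mc₂ φ e y (EuclideanSpace.single 1 1)) := by
    intro e he y hy
    apply acRel_mc h he.1 hy
    rw [he.2 y hy, zero_smul, one_smul, zero_add]
  have hdε : ∀ x, diffl3 ε x = diffForm φ x := fun x => (hε x).mfderiv
  refine ⟨ε, ⟨contMDiff_of_hasMFDerivAt h hε, fun x => ?_⟩, fun e he y hy => ?_,
    fun x v w hvw => ?_, fun e he y hy => ?_, fun e he y hy => ?_, fun x v w => ?_⟩
  · rw [(hε x).mfderiv]
    exact (injective_iff_map_eq_zero (diffForm φ x)).2 fun v hv =>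
      diffForm_eq_zero hφ.1 (hΛ x v) hv
  · obtain ⟨h0, h1⟩ := (hiso he y hy).tilde_eq
    rw [hpd he.1 y hy, hpd he.1 y hy, h0, h1, mc₁_apply h he.1 hy, mc₁_apply h he.1 hy]
    exact ⟨rfl, rfl⟩
  · rw [hdε, diffForm_apply]
    have h1 : logDiff φ x w = lg₁ (φ x) (acs (φ x) (diffl φ x v)) := by
      rw [← hvw]
      rfl
    have h2 : logDiff φ x v = lg₁ (φ x) (diffl φ x v) := rfl
    have h3 := sqrt_three_ne_zero
    rw [h1, h2, lg₁_acs]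
    match_scalars <;> field_simp
    norm_num
  · have hn := e.open_target.mem_nhds hy
    have e0 := pd_congr 0 (Filter.eventually_of_mem hn fun z hz => hpd he.1 z hz 0)
    have e1 := pd_congr 1 (Filter.eventually_of_mem hn fun z hz => hpd he.1 z hz 1)
    rw [e0, e1, hpd he.1 y hy, hpd he.1 y hy]
    exact (acFrame_mc h he.1 hy).pd_add_pd (Filter.eventually_of_mem hn (hiso he))
  · have hn := e.open_target.mem_nhds hy
    -- Conformality at y follows from the direction ∂₀ alone, J∂₀ being controlled by `ACRel`.
    have hq := inner_lg_of_holDiff_eq_zero h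
      (hΛ (e.symm y) (mfderiv (𝓡 2) (𝓡 2) e.symm y (EuclideanSpace.single 0 1)))
    rw [← fderiv_ambient_comp_symm h he.1 hy, ← mc₁_apply h he.1 hy,
      ← mc₂_apply h he.1 hy] at hq
    refine (acFrame_mc h he.1 hy).meanCurvature_eq ?_
      (Filter.eventually_of_mem hn fun z hz => hpd he.1 z hz 0)
      (Filter.eventually_of_mem hn fun z hz => hpd he.1 z hz 1) hq.1 hq.2 ?_
    · filter_upwards [hn] with z hz
      obtain ⟨a, b, hb, hab⟩ := he.2 z hz
      exact ⟨a, b, hb, acRel_mc h he.1 hz hab⟩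
    · rw [← diffForm_comp_mfderiv h he.1 hy]
      intro h0
      exact mfderiv_symm_single_ne_zero he.1 hy 0 (diffForm_eq_zero hφ.1 (hΛ _ _) h0)
  · rw [hdε]
    exact inner_diffForm h (hΛ x) v w
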